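/- All graphs are finite, simple and undirected. For a graph $G$ let $Q(G)=D(G)+A(G)$ be its signless Laplacian, where $D(G)$ is the diagonal matrix of vertex degrees and $A(G)$ the adjacency matrix, and let $q(G)$ denote the least eigenvalue of $Q(G)$. A $\theta$-graph is a graph that is the union of three distinct paths with the same two distinct ends, no two of which share a vertex other than these ends (such a graph is 2-connected). Let $C_n=v_0v_1\cdots v_{n-1}v_0$ be the cycle of order $n$. For odd $n\ge 5$ and $1\le i\le (n-3)/2$ let $H(i)=C_n+v_iv_{n-i}$ be obtained from $C_n$ by adding the chord $v_iv_{n-i}$. For even $n\ge 4$ let $\Theta$ be the graph of order $n$ obtained from the cycle $v_1v_2\cdots v_{n-1}v_1$ of length $n-1$ by adding a vertex $v_0$ and the two edges $v_0v_2$ and $v_0v_{n-1}$. Theorem. Let $G$ be a nonbipartite $\theta$-graph of order $n\ge 4$. (i) If $n$ is odd, then $q(C_n)\le q(G)$. Moreover, if equality holds, then $G\cong C_n$ or $G\cong H(i)$ for some $1\le i\le (n-3)/2$. (ii) If $n$ is even, then $q(\Theta)\le q(G)$, with equality if and only if $G\cong\Theta$. -/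

import Mathlib

namespace ThetaQ

/-- The signless Laplacian `Q(G) = D(G) + A(G)` of a finite simple graph: the diagonal matrix of
vertex degrees plus the adjacency matrix. -/
noncomputable def signlessLaplacian {V : Type*} [Fintype V] (G : SimpleGraph V) :
    Matrix V V ℝ :=
  open Classical in G.degMatrix ℝ + G.adjMatrix ℝ

/-- The least eigenvalue `q(G)` of the signless Laplacian. For a nonempty finite vertex set the set
of eigenvalues is finite and nonempty, so that the infimum is attained
(see `isLeast_leastQEigenvalue`). -/
noncomputable def leastQEigenvalue {V : Type*} [Fintype V] (G : SimpleGraph V) : ℝ :=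
  open Classical in
  sInf {μ : ℝ | Module.End.HasEigenvalue (Matrix.toLin' (signlessLaplacian G)) μ}

open Classical in
/-- `leastQEigenvalue G` is indeed the least eigenvalue of the signless Laplacian. -/
theorem isLeast_leastQEigenvalue {V : Type*} [Fintype V] [Nonempty V]
    (G : SimpleGraph V) :
    IsLeast {μ : ℝ | Module.End.HasEigenvalue (Matrix.toLin' (signlessLaplacian G)) μ}
      (leastQEigenvalue G) := by
  have hH : (signlessLaplacian G).IsHermitian := by
    unfold signlessLaplacian SimpleGraph.degMatrix
    refine Matrix.IsHermitian.add (Matrix.isHermitian_diagonal _) ?_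
    rw [Matrix.IsHermitian, Matrix.conjTranspose_eq_transpose_of_trivial]
    exact SimpleGraph.isSymm_adjMatrix G
  have hS : {μ : ℝ | Module.End.HasEigenvalue (Matrix.toLin' (signlessLaplacian G)) μ}
      = Set.range hH.eigenvalues := by
    rw [← hH.spectrum_real_eq_range_eigenvalues, ← Matrix.spectrum_toLin']
    ext μ
    exact Module.End.hasEigenvalue_iff_mem_spectrum
  unfold leastQEigenvalue
  rw [hS]
  exact ⟨(Set.range_nonempty _).csInf_mem (Set.finite_range _),
    fun _ h => csInf_le (Set.finite_range _).bddBelow h⟩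

/-- Two walks from `u` to `v` are inner disjoint: they have no common vertex besides the ends. -/
def InnerDisjoint {V : Type*} {G : SimpleGraph V} {u v : V} (p q : G.Walk u v) : Prop :=
  ∀ w, w ∈ p.support → w ∈ q.support → w = u ∨ w = v

/-- A θ-graph: the union of three distinct, pairwise inner disjoint paths with common ends `u ≠ v`,
that is, these paths together contain all vertices and all edges. (Since the paths are distinct
and the graph is simple, at most one of them is a single edge; such a graph is automatically
2-connected.) -/
def IsThetaGraph {V : Type*} (G : SimpleGraph V) : Prop :=
  ∃ (u v : V) (p₁ p₂ p₃ : G.Walk u v),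
    u ≠ v ∧
    p₁.IsPath ∧ p₂.IsPath ∧ p₃.IsPath ∧
    p₁ ≠ p₂ ∧ p₁ ≠ p₃ ∧ p₂ ≠ p₃ ∧
    InnerDisjoint p₁ p₂ ∧ InnerDisjoint p₁ p₃ ∧ InnerDisjoint p₂ p₃ ∧
    (∀ w, w ∈ p₁.support ∨ w ∈ p₂.support ∨ w ∈ p₃.support) ∧
    (∀ e ∈ G.edgeSet, e ∈ p₁.edges ∨ e ∈ p₂.edges ∨ e ∈ p₃.edges)

/-- `H(i)` (used for odd `n ≥ 5` and `1 ≤ i ≤ (n - 3) / 2`): the cycle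
`v₀ v₁ ⋯ vₙ₋₁ v₀` together with the chord joining `vᵢ` and `vₙ₋ᵢ`. -/
def chordedCycle (n i : ℕ) : SimpleGraph (Fin n) :=
  SimpleGraph.cycleGraph n ⊔
    SimpleGraph.fromRel fun a b => (a : ℕ) = i ∧ (b : ℕ) = n - i

/-- `Θ(j, k)` (used for even `n ≥ 4` and `1 ≤ j < k ≤ n - 1`): the cycle
`v₁ v₂ ⋯ vₙ₋₁ v₁` of length `n - 1` together with one further vertex `v₀`, adjacent to `vⱼ` and
`vₖ` only. -/
def cyclePlusVertex (n j k : ℕ) : SimpleGraph (Fin n) :=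
  SimpleGraph.fromRel fun a b =>
    (1 ≤ (a : ℕ) ∧ (b : ℕ) = a + 1) ∨
    ((a : ℕ) = n - 1 ∧ (b : ℕ) = 1) ∨
    ((a : ℕ) = 0 ∧ ((b : ℕ) = j ∨ (b : ℕ) = k))

/-- `Θ = Θ(2, n - 1)`, used for even `n ≥ 4`. -/
def bigTheta (n : ℕ) : SimpleGraph (Fin n) := cyclePlusVertex n 2 (n - 1)

end ThetaQ

/-!
For `n` vertices, a nonbipartite θ-graph has path lengths `a`, `b`, `c` with `a + b + c = n + 1`,
where `a` and `b` have the same parity and `c` has the other one. Write a candidate eigenvalue as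
`2 - 2 cos (2 τ)` and multiply an eigenfunction by alternating signs along the paths. On each path
the eigenvalue equation becomes `s k + s (k + 2) = 2 cos (2 τ) s (k + 1)`, which determines the
values next to the ends from the values at the ends. The equations at the two ends then decouple
into their sum and their difference, and `τ` has to be a zero of
`symmChar a b c τ = tan (a τ) + tan (b τ) - cot (c τ) - tan τ` or of
`antisymmChar a b c τ = tan (c τ) - cot (a τ) - cot (b τ) - tan τ`
(`ThetaModel.char_eq_zero`). In the range of angles that matters, `antisymmChar` is negative.
Conversely the explicit solutions on the paths, glued at the ends, give a test function whose
Rayleigh quotient lies below `2 - 2 cos (2 τ)` as soon as `symmChar a b c τ > 0`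
(`ThetaModel.leastQEigenvalue_lt`).

For odd `n`, convexity of the tangent gives
`symmChar a b c τ ≤ tan ((a + b - 1) τ) - cot (c τ)`, which is at most `0` for `n τ ≤ π / 2` since
`(a + b - 1) + c = n`. Both inequalities are equalities only if `τ = π / (2 n)` and `a = 1` or
`b = 1`. So the least eigenvalue is at least `2 - 2 cos (π / n)`, an eigenvalue of the cycle, and
equality forces a path of length one, which is the chord of a Hamiltonian cycle.

For even `n` the lengths `a` and `b` are even. The test function with `τ = π / (2 (n - 1))` shows
that only the range `(n - 1) τ < π / 2` has to be considered. There
`symmChar a b c τ < symmChar 2 2 (n - 3) τ` unless `a = b = 2`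
(`symmChar_lt_symmChar_two_two`), so a zero for `a, b, c` makes the test function on `Θ` strictly
better, which gives `q(Θ) < q(G)` (`ThetaModel.lengths_eq_of_le`).
-/

/-! ### The signless Laplacian as an operator on functions -/

namespace ThetaQ

section Spectral

variable {V W : Type*} [Fintype V] [Fintype W]

/-- The action of the signless Laplacian on a function `x`, as a sum over the neighbours of `w`. It
does not mention any decidability instance. -/
noncomputable def signlessAction (G : SimpleGraph V) (x : V → ℝ) (w : V) : ℝ :=
  open Classical in ∑ w' with G.Adj w w', (x w + x w')

theorem signlessAction_eq_sum (G : SimpleGraph V) (x : V → ℝ) (w : V) (s : Finset V)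
    (hs : ∀ w', w' ∈ s ↔ G.Adj w w') : signlessAction G x w = ∑ w' ∈ s, (x w + x w') := by
  classical
  unfold signlessAction
  refine Finset.sum_congr ?_ fun _ _ => rfl
  ext w'
  simp [hs]

theorem signlessLaplacian_mulVec (G : SimpleGraph V) (x : V → ℝ) (w : V) :
    (signlessLaplacian G).mulVec x w = signlessAction G x w := by
  classical
  unfold signlessLaplacian
  rw [Matrix.add_mulVec, Pi.add_apply, SimpleGraph.degMatrix_mulVec_apply,
    SimpleGraph.adjMatrix_mulVec_apply,
    signlessAction_eq_sum G x w (G.neighborFinset w) (by simp), Finset.sum_add_distrib,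
    Finset.sum_const, SimpleGraph.card_neighborFinset_eq_degree, nsmul_eq_mul]

theorem signlessLaplacian_isHermitian (G : SimpleGraph V) :
    (signlessLaplacian G).IsHermitian := by
  classical
  unfold signlessLaplacian SimpleGraph.degMatrix
  refine Matrix.IsHermitian.add (Matrix.isHermitian_diagonal _) ?_
  rw [Matrix.IsHermitian, Matrix.conjTranspose_eq_transpose_of_trivial]
  exact SimpleGraph.isSymm_adjMatrix G

open Classical in
theorem hasEigenvalue_signlessLaplacian_iff (G : SimpleGraph V) (μ : ℝ) :
    Module.End.HasEigenvalue (Matrix.toLin' (signlessLaplacian G)) μ ↔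
      ∃ x : V → ℝ, x ≠ 0 ∧ ∀ w, signlessAction G x w = μ * x w := by
  constructor
  · intro h
    obtain ⟨x, hx⟩ := h.exists_hasEigenvector
    refine ⟨x, hx.2, fun w => ?_⟩
    have h1 := congrFun hx.apply_eq_smul w
    rwa [Matrix.toLin'_apply, signlessLaplacian_mulVec, Pi.smul_apply, smul_eq_mul] at h1
  · rintro ⟨x, hx0, hx⟩
    refine Module.End.hasEigenvalue_of_hasEigenvector (x := x) ⟨?_, hx0⟩
    rw [Module.End.mem_eigenspace_iff]
    ext w
    rw [Matrix.toLin'_apply, signlessLaplacian_mulVec, hx, Pi.smul_apply, smul_eq_mul]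

theorem exists_eigenfunction_leastQEigenvalue [Nonempty V] (G : SimpleGraph V) :
    ∃ x : V → ℝ, x ≠ 0 ∧ ∀ w, signlessAction G x w = leastQEigenvalue G * x w :=
  (hasEigenvalue_signlessLaplacian_iff G _).1 (isLeast_leastQEigenvalue G).1

theorem leastQEigenvalue_le_of_eigenfunction [Nonempty V] (G : SimpleGraph V) {μ : ℝ} {x : V → ℝ}
    (hx0 : x ≠ 0) (hx : ∀ w, signlessAction G x w = μ * x w) : leastQEigenvalue G ≤ μ :=
  (isLeast_leastQEigenvalue G).2 ((hasEigenvalue_signlessLaplacian_iff G μ).2 ⟨x, hx0, hx⟩)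

/-- The Rayleigh principle for the least eigenvalue of the signless Laplacian. -/
theorem leastQEigenvalue_mul_sum_sq_le [Nonempty V] (G : SimpleGraph V) (x : V → ℝ) :
    leastQEigenvalue G * ∑ w, x w ^ 2 ≤ ∑ w, x w * signlessAction G x w := by
  classical
  set q := leastQEigenvalue G with hq
  have hH : (signlessLaplacian G - q • (1 : Matrix V V ℝ)).IsHermitian := by
    refine (signlessLaplacian_isHermitian G).sub ?_
    rw [Matrix.IsHermitian, Matrix.conjTranspose_smul, Matrix.conjTranspose_one]
    simp
  have hmul : ∀ y : V → ℝ, ∀ w, (signlessLaplacian G - q • (1 : Matrix V V ℝ)).mulVec y w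
      = signlessAction G y w - q * y w := by
    intro y w
    rw [Matrix.sub_mulVec, Pi.sub_apply, signlessLaplacian_mulVec, Matrix.smul_mulVec,
      Matrix.one_mulVec, Pi.smul_apply, smul_eq_mul]
  -- Its eigenvalues are those of the signless Laplacian, shifted by the least one.
  have hpsd : (signlessLaplacian G - q • (1 : Matrix V V ℝ)).PosSemidef := by
    rw [hH.posSemidef_iff_eigenvalues_nonneg]
    intro i
    have hv := hH.mulVec_eigenvectorBasis i
    set v : V → ℝ := ⇑(hH.eigenvectorBasis i) with hvdef
    have hv0 : v ≠ 0 := by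
      intro h0
      have h1 := hH.eigenvectorBasis.orthonormal.ne_zero i
      apply h1
      ext w
      exact congrFun h0 w
    have : q ≤ q + hH.eigenvalues i := by
      refine leastQEigenvalue_le_of_eigenfunction G hv0 fun w => ?_
      have h2 := congrFun hv w
      rw [hmul, Pi.smul_apply, smul_eq_mul] at h2
      linarith
    simpa using this
  have h := hpsd.dotProduct_mulVec_nonneg x
  have h2 : star x ⬝ᵥ (signlessLaplacian G - q • (1 : Matrix V V ℝ)).mulVec x
      = ∑ w, x w * signlessAction G x w - q * ∑ w, x w ^ 2 := by
    rw [dotProduct, Finset.mul_sum, ← Finset.sum_sub_distrib]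
    refine Finset.sum_congr rfl fun w _ => ?_
    rw [hmul, Pi.star_apply, star_trivial]
    ring
  rw [h2] at h
  linarith

/-- The quadratic form of the signless Laplacian is a sum of squares over the (oriented) edges. -/
theorem two_mul_sum_mul_signlessAction (G : SimpleGraph V) (x : V → ℝ) :
    open Classical in
    2 * ∑ w, x w * signlessAction G x w
      = ∑ w, ∑ w', if G.Adj w w' then (x w + x w') ^ 2 else 0 := by
  classical
  have h1 : ∑ w, x w * signlessAction G x w
      = ∑ w, ∑ w', if G.Adj w w' then x w * (x w + x w') else 0 := by
    refine Finset.sum_congr rfl fun w _ => ?_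
    rw [signlessAction_eq_sum G x w (Finset.univ.filter (G.Adj w)) (by simp), Finset.mul_sum,
      Finset.sum_filter]
  -- The same sum with the roles of the two ends of each edge exchanged.
  have h2 : ∑ w, x w * signlessAction G x w
      = ∑ w, ∑ w', if G.Adj w w' then x w' * (x w + x w') else 0 := by
    rw [h1, Finset.sum_comm]
    refine Finset.sum_congr rfl fun w _ => Finset.sum_congr rfl fun w' _ => ?_
    simp only [G.adj_comm w' w, add_comm (x w')]
  rw [two_mul]
  nth_rewrite 1 [h1]
  rw [h2, ← Finset.sum_add_distrib]
  refine Finset.sum_congr rfl fun w _ => ?_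
  rw [← Finset.sum_add_distrib]
  refine Finset.sum_congr rfl fun w' _ => ?_
  split_ifs <;> ring

/-- An eigenfunction for a nonpositive eigenvalue changes sign along every edge. -/
theorem eq_neg_of_adj_of_eigenvalue_nonpos (G : SimpleGraph V) {μ : ℝ} (hμ : μ ≤ 0) {x : V → ℝ}
    (hx : ∀ w, signlessAction G x w = μ * x w) {w w' : V} (hw : G.Adj w w') : x w' = -x w := by
  classical
  have h1 := two_mul_sum_mul_signlessAction G x
  have h2 : ∑ w, x w * signlessAction G x w ≤ 0 := by
    refine Finset.sum_nonpos fun w _ => ?_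
    rw [hx]
    nlinarith [sq_nonneg (x w)]
  have hnn : ∀ w w', 0 ≤ if G.Adj w w' then (x w + x w') ^ 2 else 0 := by
    intro w w'
    split_ifs <;> positivity
  have h3 : ∑ w, ∑ w', (if G.Adj w w' then (x w + x w') ^ 2 else 0) = 0 := by
    refine le_antisymm ?_ (Finset.sum_nonneg fun w _ => Finset.sum_nonneg fun w' _ => hnn w w')
    rw [← h1]
    linarith
  rw [Finset.sum_eq_zero_iff_of_nonneg
    fun w _ => Finset.sum_nonneg fun w' _ => hnn w w'] at h3
  have h4 := h3 w (Finset.mem_univ _)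
  rw [Finset.sum_eq_zero_iff_of_nonneg fun w' _ => hnn w w'] at h4
  have h5 := h4 w' (Finset.mem_univ _)
  rw [if_pos hw] at h5
  have h6 : x w + x w' = 0 := by simpa using h5
  linarith

theorem signlessAction_comp_iso {G : SimpleGraph V} {H : SimpleGraph W} (e : G ≃g H) (x : W → ℝ)
    (w : V) : signlessAction G (x ∘ e) w = signlessAction H x (e w) := by
  classical
  rw [signlessAction_eq_sum G _ w (Finset.univ.filter (G.Adj w)) (by simp),
    signlessAction_eq_sum H _ (e w) ((Finset.univ.filter (G.Adj w)).map e.toEquiv.toEmbedding),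
    Finset.sum_map]
  · rfl
  · intro w'
    simp only [Finset.mem_map, Finset.mem_filter, Finset.mem_univ, true_and]
    constructor
    · rintro ⟨z, hz, rfl⟩
      exact e.map_adj_iff.2 hz
    · intro h
      refine ⟨e.symm w', ?_, e.apply_symm_apply w'⟩
      rw [← e.map_adj_iff]
      simpa using h

theorem leastQEigenvalue_le_of_iso [Nonempty V] [Nonempty W] {G : SimpleGraph V}
    {H : SimpleGraph W} (e : G ≃g H) : leastQEigenvalue G ≤ leastQEigenvalue H := by
  obtain ⟨x, hx0, hx⟩ := exists_eigenfunction_leastQEigenvalue H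
  refine leastQEigenvalue_le_of_eigenfunction G (x := x ∘ e) ?_ fun w => ?_
  · intro h
    apply hx0
    ext w
    have := congrFun h (e.symm w)
    simpa using this
  · rw [signlessAction_comp_iso, hx]
    rfl

theorem leastQEigenvalue_eq_of_iso [Nonempty V] [Nonempty W] {G : SimpleGraph V}
    {H : SimpleGraph W} (e : G ≃g H) : leastQEigenvalue G = leastQEigenvalue H :=
  le_antisymm (leastQEigenvalue_le_of_iso e) (leastQEigenvalue_le_of_iso e.symm)

end Spectral

end ThetaQ

/-! ### Parametrized θ-graphs -/

namespace ThetaQ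

/-- A parametrization of a θ-graph by three sequences of vertices: `P i 0, P i 1, …, P i (ℓ i)` is
the `i`-th path, of length `ℓ i`. Values of `P i` beyond `ℓ i` are irrelevant. Any two paths have
total length at least `3`, because a simple graph has no parallel edges. -/
structure ThetaModel {V : Type*} (G : SimpleGraph V) (ℓ : Fin 3 → ℕ) (P : Fin 3 → ℕ → V) :
    Prop where
  start_eq : ∀ i j, P i 0 = P j 0
  end_eq : ∀ i j, P i (ℓ i) = P j (ℓ j)
  inj : ∀ i j k l, k ≤ ℓ i → l ≤ ℓ j → P i k = P j l →
    (i = j ∧ k = l) ∨ (k = 0 ∧ l = 0) ∨ (k = ℓ i ∧ l = ℓ j)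
  cover : ∀ w, ∃ i k, k ≤ ℓ i ∧ P i k = w
  adj_iff : ∀ w w', G.Adj w w' ↔
    ∃ i k, k < ℓ i ∧ ((w = P i k ∧ w' = P i (k + 1)) ∨ (w' = P i k ∧ w = P i (k + 1)))
  one_le : ∀ i, 1 ≤ ℓ i
  three_le : ∀ i j, i ≠ j → 3 ≤ ℓ i + ℓ j

namespace ThetaModel

variable {V W : Type*} {G : SimpleGraph V} {H : SimpleGraph W} {ℓ : Fin 3 → ℕ}
  {P : Fin 3 → ℕ → V} {R : Fin 3 → ℕ → W}

theorem perm (h : ThetaModel G ℓ P) (σ : Equiv.Perm (Fin 3)) :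
    ThetaModel G (fun i => ℓ (σ i)) (fun i => P (σ i)) where
  start_eq i j := h.start_eq _ _
  end_eq i j := h.end_eq _ _
  inj i j k l hk hl hkl := by
    simpa using h.inj (σ i) (σ j) k l hk hl hkl
  cover w := by
    obtain ⟨i, k, hk⟩ := h.cover w
    exact ⟨σ.symm i, k, by simpa using hk⟩
  adj_iff w w' := by
    rw [h.adj_iff]
    constructor
    · rintro ⟨i, k, hk⟩
      exact ⟨σ.symm i, k, by simpa using hk⟩
    · rintro ⟨i, k, hk⟩
      exact ⟨σ i, k, hk⟩
  one_le i := h.one_le _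
  three_le i j hij := h.three_le _ _ (by simpa using hij)

theorem reverse (h : ThetaModel G ℓ P) : ThetaModel G ℓ (fun i k => P i (ℓ i - k)) where
  start_eq i j := by simpa using h.end_eq i j
  end_eq i j := by simpa using h.start_eq i j
  inj i j k l hk hl hkl := by
    rcases h.inj i j _ _ (Nat.sub_le _ _) (Nat.sub_le _ _) hkl with ⟨rfl, h2⟩ | h2 | h2
    · left
      omega
    · right; right; omega
    · right; left; omega
  cover w := by
    obtain ⟨i, k, hk, hw⟩ := h.cover w
    exact ⟨i, ℓ i - k, Nat.sub_le _ _, by rwa [Nat.sub_sub_self hk]⟩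
  adj_iff w w' := by
    rw [h.adj_iff]
    constructor
    · rintro ⟨i, k, hk, hw⟩
      refine ⟨i, ℓ i - (k + 1), by omega, ?_⟩
      rw [show ℓ i - (ℓ i - (k + 1)) = k + 1 by omega,
        show ℓ i - (ℓ i - (k + 1) + 1) = k by omega]
      tauto
    · rintro ⟨i, k, hk, hw⟩
      refine ⟨i, ℓ i - (k + 1), by omega, ?_⟩
      rw [show ℓ i - (k + 1) + 1 = ℓ i - k by omega]
      tauto
  one_le := h.one_le
  three_le := h.three_le

/-- Functions on the three paths that agree at the common ends define a function on the vertices. -/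
theorem exists_lift {α : Type*} (h : ThetaModel G ℓ P) (Y : Fin 3 → ℕ → α)
    (h0 : ∀ i j, Y i 0 = Y j 0) (h1 : ∀ i j, Y i (ℓ i) = Y j (ℓ j)) :
    ∃ y : V → α, ∀ i k, k ≤ ℓ i → y (P i k) = Y i k := by
  choose I K hK hP using h.cover
  refine ⟨fun w => Y (I w) (K w), fun i k hk => ?_⟩
  rcases h.inj _ _ _ _ (hK (P i k)) hk (hP (P i k)) with ⟨h2, h3⟩ | ⟨h2, h3⟩ | ⟨h2, h3⟩
  · simp only [h2, h3]
  · simp only [h2]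
    rw [h3]
    exact h0 _ _
  · simp only [h2]
    rw [h3]
    exact h1 _ _

/-- A θ-graph is determined up to isomorphism by the lengths of its three paths. -/
theorem nonempty_iso (h : ThetaModel G ℓ P) (h' : ThetaModel H ℓ R) : Nonempty (G ≃g H) := by
  obtain ⟨f, hf⟩ := h.exists_lift R h'.start_eq h'.end_eq
  obtain ⟨g, hg⟩ := h'.exists_lift P h.start_eq h.end_eq
  have hgf : ∀ w, g (f w) = w := by
    intro w
    obtain ⟨i, k, hk, rfl⟩ := h.cover w
    rw [hf i k hk, hg i k hk]
  have hfg : ∀ w, f (g w) = w := by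
    intro w
    obtain ⟨i, k, hk, rfl⟩ := h'.cover w
    rw [hg i k hk, hf i k hk]
  have hadj : ∀ w w', G.Adj w w' → H.Adj (f w) (f w') := by
    intro w w' hw
    obtain ⟨i, k, hk, hw⟩ := (h.adj_iff _ _).1 hw
    refine (h'.adj_iff _ _).2 ⟨i, k, hk, ?_⟩
    rcases hw with ⟨rfl, rfl⟩ | ⟨rfl, rfl⟩
    · left; exact ⟨hf _ _ hk.le, hf _ _ hk⟩
    · right; exact ⟨hf _ _ hk.le, hf _ _ hk⟩
  have hadj' : ∀ w w', H.Adj w w' → G.Adj (g w) (g w') := by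
    intro w w' hw
    obtain ⟨i, k, hk, hw⟩ := (h'.adj_iff _ _).1 hw
    refine (h.adj_iff _ _).2 ⟨i, k, hk, ?_⟩
    rcases hw with ⟨rfl, rfl⟩ | ⟨rfl, rfl⟩
    · left; exact ⟨hg _ _ hk.le, hg _ _ hk⟩
    · right; exact ⟨hg _ _ hk.le, hg _ _ hk⟩
  refine ⟨⟨⟨f, g, hgf, hfg⟩, ?_⟩⟩
  intro w w'
  constructor
  · intro hw
    have := hadj' _ _ hw
    simpa [hgf] using this
  · exact hadj w w'

theorem start_ne_end (h : ThetaModel G ℓ P) (i j : Fin 3) : P i 0 ≠ P j (ℓ j) := by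
  intro he
  rw [h.end_eq j i] at he
  have := h.inj i i 0 (ℓ i) (Nat.zero_le _) le_rfl he
  have := h.one_le i
  omega

/-- Each path contributes `ℓ i - 1` interior vertices, besides the two common ends. -/
theorem card_add_one [Fintype V] (h : ThetaModel G ℓ P) :
    Fintype.card V + 1 = ℓ 0 + ℓ 1 + ℓ 2 := by
  classical
  have huniv : (Finset.univ : Finset V) = insert (P 0 0) (insert (P 0 (ℓ 0))
      (Finset.univ.biUnion fun i => (Finset.Ico 1 (ℓ i)).image (P i))) := by
    ext w
    simp only [Finset.mem_univ, Finset.mem_insert, Finset.mem_biUnion, Finset.mem_image,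
      Finset.mem_Ico, true_and, true_iff]
    obtain ⟨i, k, hk, rfl⟩ := h.cover w
    rcases Nat.eq_zero_or_pos k with rfl | hk0
    · left; exact h.start_eq _ _
    · rcases hk.eq_or_lt with rfl | hk1
      · right; left; exact h.end_eq _ _
      · right; right; exact ⟨i, k, ⟨hk0, hk1⟩, rfl⟩
  have hcard : (Finset.univ.biUnion fun i => (Finset.Ico 1 (ℓ i)).image (P i)).card
      = ∑ i, (ℓ i - 1) := by
    rw [Finset.card_biUnion]
    · refine Finset.sum_congr rfl fun i _ => ?_
      rw [Finset.card_image_of_injOn, Nat.card_Ico]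
      intro k hk l hl hkl
      simp only [Finset.coe_Ico, Set.mem_Ico] at hk hl
      have := h.inj i i k l hk.2.le hl.2.le hkl
      omega
    · intro i _ j _ hij
      rw [Function.onFun, Finset.disjoint_left]
      intro w hw hw'
      simp only [Finset.mem_image, Finset.mem_Ico] at hw hw'
      obtain ⟨k, hk, rfl⟩ := hw
      obtain ⟨l, hl, hkl⟩ := hw'
      have := h.inj j i l k hl.2.le hk.2.le hkl
      rcases this with h1 | h1 | h1
      · exact hij h1.1.symm
      · omega
      · omega
  have h1 : P 0 (ℓ 0) ∉ Finset.univ.biUnion fun i => (Finset.Ico 1 (ℓ i)).image (P i) := by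
    simp only [Finset.mem_biUnion, Finset.mem_image, Finset.mem_Ico, Finset.mem_univ, true_and]
    rintro ⟨i, k, hk, hkl⟩
    rw [h.end_eq 0 i] at hkl
    have := h.inj i i _ _ hk.2.le le_rfl hkl
    omega
  have h0 : P 0 0 ∉ insert (P 0 (ℓ 0))
      (Finset.univ.biUnion fun i => (Finset.Ico 1 (ℓ i)).image (P i)) := by
    simp only [Finset.mem_insert, Finset.mem_biUnion, Finset.mem_image, Finset.mem_Ico,
      Finset.mem_univ, true_and, not_or]
    refine ⟨h.start_ne_end _ _, ?_⟩
    rintro ⟨i, k, hk, hkl⟩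
    rw [h.start_eq 0 i] at hkl
    have := h.inj i i _ _ hk.2.le (Nat.zero_le _) hkl
    omega
  have := congrArg Finset.card huniv
  rw [Finset.card_insert_of_notMem h0, Finset.card_insert_of_notMem h1, hcard, Finset.card_univ,
    Fin.sum_univ_three] at this
  have := h.one_le 0
  have := h.one_le 1
  have := h.one_le 2
  omega

/-- If the lengths of all three paths have the same parity, then the parity of the position on a
path is a proper 2-colouring. -/
theorem isBipartite (h : ThetaModel G ℓ P) (hpar : ∀ i j, ℓ i % 2 = ℓ j % 2) :
    G.IsBipartite := by
  obtain ⟨c, hc⟩ := h.exists_lift (fun _ k => (Fin.ofNat 2 k : Fin 2)) (fun _ _ => rfl)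
    (fun i j => by simp [Fin.ext_iff, hpar i j])
  refine ⟨SimpleGraph.Coloring.mk c ?_⟩
  intro w w' hw
  obtain ⟨i, k, hk, hw⟩ := (h.adj_iff _ _).1 hw
  rcases hw with ⟨rfl, rfl⟩ | ⟨rfl, rfl⟩ <;> rw [hc _ _ hk.le, hc _ _ hk] <;>
    simp only [Fin.ofNat, ne_eq, Fin.mk.injEq] <;> omega

/-- After renumbering the paths of a nonbipartite θ-graph, the first two lengths have the same
parity and the third has the other one. -/
theorem exists_parity (h : ThetaModel G ℓ P) (hnb : ¬ G.IsBipartite) :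
    ∃ (ℓ' : Fin 3 → ℕ) (P' : Fin 3 → ℕ → V), ThetaModel G ℓ' P' ∧
      ℓ' 0 % 2 = ℓ' 1 % 2 ∧ ℓ' 2 % 2 ≠ ℓ' 0 % 2 := by
  by_cases h01 : ℓ 0 % 2 = ℓ 1 % 2
  · refine ⟨ℓ, P, h, h01, fun h20 => hnb (h.isBipartite ?_)⟩
    intro i j
    fin_cases i <;> fin_cases j <;> simp <;> omega
  · by_cases h02 : ℓ 0 % 2 = ℓ 2 % 2
    · exact ⟨_, _, h.perm (Equiv.swap 1 2), by simpa [Equiv.swap_apply_def] using h02,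
        by simpa [Equiv.swap_apply_def] using fun e => h01 e.symm⟩
    · refine ⟨_, _, h.perm (Equiv.swap 0 2), ?_, ?_⟩
      · simp [Equiv.swap_apply_def]; omega
      · simpa [Equiv.swap_apply_def] using h02

section Action

variable [Fintype V]

theorem signlessAction_interior (h : ThetaModel G ℓ P) (x : V → ℝ) (i : Fin 3) (k : ℕ)
    (hk : k + 1 < ℓ i) :
    signlessAction G x (P i (k + 1)) = 2 * x (P i (k + 1)) + x (P i k) + x (P i (k + 2)) := by
  classical
  rw [signlessAction_eq_sum G x _ {P i k, P i (k + 2)}, Finset.sum_pair]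
  · ring
  · intro he
    have := h.inj i i _ _ (by omega) (by omega) he
    omega
  · intro w'
    rw [h.adj_iff]
    simp only [Finset.mem_insert, Finset.mem_singleton]
    constructor
    · rintro (rfl | rfl)
      · exact ⟨i, k, by omega, Or.inr ⟨rfl, rfl⟩⟩
      · exact ⟨i, k + 1, by omega, Or.inl ⟨rfl, rfl⟩⟩
    · rintro ⟨j, l, hl, ⟨he, rfl⟩ | ⟨rfl, he⟩⟩
      · rcases h.inj _ _ _ _ hk.le hl.le he with ⟨rfl, rfl⟩ | h1 | h1
        · right; rfl
        · omega
        · omega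
      · rcases h.inj _ _ _ _ hk.le hl he with ⟨rfl, h1⟩ | h1 | h1
        · left
          rw [show l = k by omega]
        · omega
        · omega

theorem signlessAction_start (h : ThetaModel G ℓ P) (x : V → ℝ) :
    signlessAction G x (P 0 0) = 3 * x (P 0 0) + (x (P 0 1) + x (P 1 1) + x (P 2 1)) := by
  classical
  rw [signlessAction_eq_sum G x _ (Finset.univ.image fun i => P i 1), Finset.sum_image,
    Fin.sum_univ_three]
  · ring
  · intro i _ j _ he
    by_contra hij
    have := h.inj i j _ _ (h.one_le i) (h.one_le j) he
    have := h.three_le i j hij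
    omega
  · intro w'
    rw [h.adj_iff]
    simp only [Finset.mem_image, Finset.mem_univ, true_and]
    constructor
    · rintro ⟨i, rfl⟩
      exact ⟨i, 0, h.one_le i, Or.inl ⟨h.start_eq _ _, rfl⟩⟩
    · rintro ⟨j, l, hl, ⟨he, rfl⟩ | ⟨rfl, he⟩⟩
      · rw [h.start_eq 0 j] at he
        have := h.inj _ _ _ _ (Nat.zero_le _) hl.le he
        refine ⟨j, ?_⟩
        rw [show l = 0 by omega]
      · rw [h.start_eq 0 j] at he
        have := h.inj _ _ _ _ (Nat.zero_le _) hl he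
        omega

/-- The equation at the second end is that at the first end of the reversed paths. -/
theorem signlessAction_end (h : ThetaModel G ℓ P) (x : V → ℝ) :
    signlessAction G x (P 0 (ℓ 0)) = 3 * x (P 0 (ℓ 0)) +
      (x (P 0 (ℓ 0 - 1)) + x (P 1 (ℓ 1 - 1)) + x (P 2 (ℓ 2 - 1))) := by
  simpa using h.reverse.signlessAction_start x

end Action

end ThetaModel

/-- Every θ-graph has a parametrization, given by the vertices of its three paths. -/
theorem IsThetaGraph.exists_model {V : Type*} {G : SimpleGraph V} (hG : IsThetaGraph G) :
    ∃ (ℓ : Fin 3 → ℕ) (P : Fin 3 → ℕ → V), ThetaModel G ℓ P := by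
  obtain ⟨u, v, p₁, p₂, p₃, huv, hp₁, hp₂, hp₃, h12, h13, h23, d12, d13, d23, hcov, hedge⟩ := hG
  set p : Fin 3 → G.Walk u v := ![p₁, p₂, p₃] with hp
  have hpath : ∀ i, (p i).IsPath := by
    intro i; fin_cases i <;> simpa [hp]
  have hne : ∀ i j, i ≠ j → p i ≠ p j := by
    intro i j hij
    fin_cases i <;> fin_cases j <;> simp_all [eq_comm]
  have hdis : ∀ i j, i ≠ j → InnerDisjoint (p i) (p j) := by
    intro i j hij
    fin_cases i <;> fin_cases j <;> first
      | exact absurd rfl hij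
      | assumption
      | (intro w hw hw'; first
          | exact d12 w hw' hw
          | exact d13 w hw' hw
          | exact d23 w hw' hw)
  have hpos : ∀ i, 1 ≤ (p i).length := by
    intro i
    by_contra h0
    exact huv (SimpleGraph.Walk.eq_of_length_eq_zero (p := p i) (by omega))
  refine ⟨fun i => (p i).length, fun i k => (p i).getVert k, ?_, ?_, ?_, ?_, ?_, hpos, ?_⟩
  · intro i j; simp
  · intro i j; simp
  · intro i j k l hk hl hkl
    by_cases hij : i = j
    · subst hij
      exact Or.inl ⟨rfl, (hpath i).getVert_injOn hk hl hkl⟩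
    · right
      rcases hdis i j hij ((p i).getVert k) ((p i).getVert_mem_support k)
        (hkl ▸ (p j).getVert_mem_support l) with h | h
      · left
        exact ⟨((hpath i).getVert_eq_start_iff hk).1 h,
          ((hpath j).getVert_eq_start_iff hl).1 (hkl ▸ h)⟩
      · right
        exact ⟨((hpath i).getVert_eq_end_iff hk).1 h,
          ((hpath j).getVert_eq_end_iff hl).1 (hkl ▸ h)⟩
  · intro w
    have : ∃ i, w ∈ (p i).support := by
      rcases hcov w with h | h | h
      · exact ⟨0, h⟩
      · exact ⟨1, h⟩
      · exact ⟨2, h⟩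
    obtain ⟨i, hi⟩ := this
    obtain ⟨k, hk, hk'⟩ := SimpleGraph.Walk.mem_support_iff_exists_getVert.1 hi
    exact ⟨i, k, hk', hk⟩
  · intro w w'
    constructor
    · intro hw
      have : ∃ i, s(w, w') ∈ (p i).edges := by
        rcases hedge s(w, w') hw with h | h | h
        · exact ⟨0, h⟩
        · exact ⟨1, h⟩
        · exact ⟨2, h⟩
      obtain ⟨i, hi⟩ := this
      rw [← SimpleGraph.Walk.mem_edges_toSubgraph, SimpleGraph.Subgraph.mem_edgeSet,
        SimpleGraph.Walk.toSubgraph_adj_iff] at hi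
      obtain ⟨k, hk, hk'⟩ := hi
      refine ⟨i, k, hk', ?_⟩
      rw [Sym2.eq_iff] at hk
      grind
    · rintro ⟨i, k, hk, ⟨rfl, rfl⟩ | ⟨rfl, rfl⟩⟩
      · exact (p i).adj_getVert_succ hk
      · exact ((p i).adj_getVert_succ hk).symm
  · intro i j hij
    -- Two paths of length one between the same ends would be equal.
    by_contra hlt
    have hi := hpos i
    have hj := hpos j
    apply hne i j hij
    have hli : (p i).length = 1 := by omega
    have hlj : (p j).length = 1 := by omega
    refine SimpleGraph.Walk.ext_getVert_le_length (hli.trans hlj.symm) fun k hk => ?_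
    rcases Nat.le_one_iff_eq_zero_or_eq_one.1 (hli ▸ hk) with rfl | rfl
    · simp
    · rw [← hli, (p i).getVert_length, hli, ← hlj, (p j).getVert_length]

end ThetaQ

/-! ### The characteristic equations of a θ-graph -/

namespace ThetaQ

open Real

/-- The function whose zeros `τ` give the eigenvalues `4 sin² τ` with an eigenfunction that, up to
the alternating sign, takes equal values at the two ends. Here `a`, `b` are the lengths of the two
paths of equal parity and `c` is the length of the third one. -/
noncomputable def symmChar (a b c : ℕ) (τ : ℝ) : ℝ :=
  tan (a * τ) + tan (b * τ) - (tan (c * τ))⁻¹ - tan τ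

/-- The function whose zeros `τ` give the eigenvalues `4 sin² τ` with an eigenfunction that, up to
the alternating sign, takes opposite values at the two ends. -/
noncomputable def antisymmChar (a b c : ℕ) (τ : ℝ) : ℝ :=
  tan (c * τ) - (tan (a * τ))⁻¹ - (tan (b * τ))⁻¹ - tan τ

/-- The explicit solution of the three-term recurrence `s k + s (k + 2) = 2 cos t * s (k + 1)`. -/
theorem mul_sin_of_recurrence {s : ℕ → ℝ} {t : ℝ} {m : ℕ}
    (hs : ∀ k, k + 1 < m → s k + s (k + 2) = 2 * cos t * s (k + 1)) :
    ∀ k, k ≤ m → s k * sin t = s 1 * sin (k * t) - s 0 * sin ((k - 1) * t) := by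
  have key : ∀ k, k + 1 ≤ m →
      s k * sin t = s 1 * sin (k * t) - s 0 * sin ((k - 1) * t) ∧
      s (k + 1) * sin t = s 1 * sin ((k + 1) * t) - s 0 * sin (k * t) := by
    intro k
    induction k with
    | zero => intro _; simp
    | succ k ih =>
      intro hk
      obtain ⟨h1, h2⟩ := ih (by omega)
      have h3 := hs k (by omega)
      have e1 : sin (((k : ℝ) + 1 + 1) * t) = 2 * cos t * sin (((k : ℝ) + 1) * t) - sin (k * t) := by
        rw [show ((k : ℝ) + 1 + 1) * t = (k + 1) * t + t by ring,
          show (k : ℝ) * t = (k + 1) * t - t by ring, sin_add, sin_sub]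
        ring
      have e2 : sin (((k : ℝ) + 1) * t) = 2 * cos t * sin ((k : ℝ) * t) - sin ((k - 1) * t) := by
        rw [show ((k : ℝ) + 1) * t = k * t + t by ring,
          show ((k : ℝ) - 1) * t = k * t - t by ring, sin_add, sin_sub]
        ring
      push_cast
      refine ⟨by rw [h2]; ring_nf, ?_⟩
      have h4 : s (k + 1 + 1) = 2 * cos t * s (k + 1) - s k := by linarith
      rw [h4, sub_mul, mul_assoc, h2, h1, e1, e2]
      ring
  intro k hk
  rcases Nat.eq_zero_or_pos k with rfl | hk0
  · simp
  · obtain ⟨k, rfl⟩ := Nat.exists_eq_add_of_lt hk0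
    have := (key k (by omega)).2
    simpa [add_comm] using this

/-- The sum and the difference of the two values next to the ends of a path, in terms of the values
at the ends. -/
theorem add_of_recurrence {s : ℕ → ℝ} {τ : ℝ} {m : ℕ} (hm : 1 ≤ m)
    (hs : ∀ k, k + 1 < m → s k + s (k + 2) = 2 * cos (2 * τ) * s (k + 1))
    (hτ : 0 < τ) (hmτ : m * τ < π / 2) :
    s 1 + s (m - 1) = (s 0 + s m) * (cos (2 * τ) + sin (2 * τ) * tan (m * τ)) ∧
    s 1 - s (m - 1) = (s 0 - s m) * (cos (2 * τ) - sin (2 * τ) * (tan (m * τ))⁻¹) := by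
  have h1 := mul_sin_of_recurrence hs m le_rfl
  -- The same recurrence, read from the other end.
  have hs' : ∀ k, k + 1 < m → s (m - k) + s (m - (k + 2)) = 2 * cos (2 * τ) * s (m - (k + 1)) := by
    intro k hk
    have := hs (m - (k + 2)) (by omega)
    rw [show m - (k + 2) + 2 = m - k by omega, show m - (k + 2) + 1 = m - (k + 1) by omega] at this
    linarith
  have h2 := mul_sin_of_recurrence (s := fun k => s (m - k)) hs' m le_rfl
  simp only [Nat.sub_self, Nat.sub_zero] at h2
  have hm0 : (1 : ℝ) ≤ m := by exact_mod_cast hm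
  have hpos : 0 < m * τ := by positivity
  have hS : 0 < sin (m * τ) := sin_pos_of_pos_of_lt_pi hpos (by linarith [pi_pos])
  have hC : 0 < cos (m * τ) := cos_pos_of_mem_Ioo ⟨by linarith [pi_pos], hmτ⟩
  rw [tan_eq_sin_div_cos, inv_div]
  have e1 : sin (m * (2 * τ)) = 2 * sin (m * τ) * cos (m * τ) := by
    rw [← sin_two_mul]; ring_nf
  have e2 : sin ((m - 1) * (2 * τ)) = 2 * sin (m * τ) * cos (m * τ) * cos (2 * τ)
      - (cos (m * τ) ^ 2 - sin (m * τ) ^ 2) * sin (2 * τ) := by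
    rw [← cos_two_mul', ← sin_two_mul, ← sin_sub]
    ring_nf
  have e3 := sin_sq_add_cos_sq (m * τ)
  rw [e1, e2] at h1 h2
  constructor
  · have e4 : (s 1 + s (m - 1)) * (2 * sin (m * τ) * cos (m * τ)) = (s 0 + s m) *
        (cos (2 * τ) * cos (m * τ) + sin (2 * τ) * sin (m * τ)) * (2 * sin (m * τ)) := by
      linear_combination (-1) * h1 - h2 - (s 0 + s m) * sin (2 * τ) * e3
    generalize (m : ℝ) * τ = φ at hS hC e4 ⊢
    field_simp
    apply mul_right_cancel₀ hS.ne'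
    linear_combination e4 / 2
  · have e4 : (s 1 - s (m - 1)) * (2 * sin (m * τ) * cos (m * τ)) = (s 0 - s m) *
        (cos (2 * τ) * sin (m * τ) - sin (2 * τ) * cos (m * τ)) * (2 * cos (m * τ)) := by
      linear_combination (-1) * h1 + h2 + (s 0 - s m) * sin (2 * τ) * e3
    generalize (m : ℝ) * τ = φ at hS hC e4 ⊢
    field_simp
    apply mul_right_cancel₀ hC.ne'
    linear_combination e4 / 2

theorem neg_one_pow_eq_of_mod {m n : ℕ} (h : m % 2 = n % 2) : (-1 : ℝ) ^ m = (-1) ^ n := by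
  rw [neg_one_pow_eq_pow_mod_two, h, ← neg_one_pow_eq_pow_mod_two]

theorem neg_one_pow_eq_neg_of_mod {m n : ℕ} (h : m % 2 ≠ n % 2) : (-1 : ℝ) ^ m = -(-1) ^ n := by
  rw [neg_one_pow_eq_of_mod (show m % 2 = (n + 1) % 2 by omega), pow_succ]
  ring

theorem one_sub_cos_two_mul {τ : ℝ} (h : cos τ ≠ 0) : 1 - cos (2 * τ) = sin (2 * τ) * tan τ := by
  rw [tan_eq_sin_div_cos, cos_two_mul, sin_two_mul]
  field_simp
  linarith [sin_sq_add_cos_sq τ]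

namespace ThetaModel

variable {V : Type*} [Fintype V] {G : SimpleGraph V} {ℓ : Fin 3 → ℕ} {P : Fin 3 → ℕ → V}

/-- Nonpositive eigenvalues are excluded when the lengths do not all have the same parity. -/
theorem eigenvalue_pos (h : ThetaModel G ℓ P) (hc : ℓ 2 % 2 ≠ ℓ 0 % 2) {μ : ℝ} {x : V → ℝ}
    (hx0 : x ≠ 0) (hx : ∀ w, signlessAction G x w = μ * x w) : 0 < μ := by
  by_contra hμ
  have hadj : ∀ w w', G.Adj w w' → x w' = -x w := fun w w' hw =>
    eq_neg_of_adj_of_eigenvalue_nonpos G (not_lt.1 hμ) hx hw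
  have hpath : ∀ i k, k ≤ ℓ i → x (P i k) = (-1) ^ k * x (P 0 0) := by
    intro i k
    induction k with
    | zero => intro _; rw [h.start_eq i 0]; simp
    | succ k ih =>
      intro hk
      rw [hadj _ _ ((h.adj_iff _ _).2 ⟨i, k, hk, Or.inl ⟨rfl, rfl⟩⟩), ih (by omega), pow_succ]
      ring
  have h0 := hpath 0 _ le_rfl
  have h2 := hpath 2 _ le_rfl
  rw [h.end_eq 2 0, h0, neg_one_pow_eq_neg_of_mod hc] at h2
  have hx00 : x (P 0 0) = 0 := by
    rcases neg_one_pow_eq_or ℝ (ℓ 0) with e | e <;> rw [e] at h2 <;> linarith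
  apply hx0
  ext w
  obtain ⟨i, k, hk, rfl⟩ := h.cover w
  rw [hpath i k hk, hx00]
  simp

/-- An eigenvalue `4 sin² τ` in the range where all three paths are shorter than a quarter period
gives a zero of one of the two characteristic functions: the alternating signs turn the eigenvalue
equation on the paths into the three-term recurrence, and the sum and the difference of the
equations at the two ends decouple. -/
theorem char_eq_zero (h : ThetaModel G ℓ P) (hab : ℓ 0 % 2 = ℓ 1 % 2) (hc : ℓ 2 % 2 ≠ ℓ 0 % 2)
    {τ : ℝ} (hτ : 0 < τ) (hℓ : ∀ i, ℓ i * τ < π / 2) {x : V → ℝ} (hx0 : x ≠ 0)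
    (hx : ∀ w, signlessAction G x w = (2 - 2 * cos (2 * τ)) * x w) :
    symmChar (ℓ 0) (ℓ 1) (ℓ 2) τ = 0 ∨ antisymmChar (ℓ 0) (ℓ 1) (ℓ 2) τ = 0 := by
  set s : Fin 3 → ℕ → ℝ := fun i k => (-1) ^ k * x (P i k) with hs
  have hrec : ∀ i k, k + 1 < ℓ i → s i k + s i (k + 2) = 2 * cos (2 * τ) * s i (k + 1) := by
    intro i k hk
    have h1 := hx (P i (k + 1))
    rw [h.signlessAction_interior x i k hk] at h1
    have h2 : x (P i k) + x (P i (k + 2)) = -(2 * cos (2 * τ) * x (P i (k + 1))) := by linarith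
    simp only [hs, pow_succ]
    linear_combination (-1) ^ k * h2
  have hone : ∀ i, (1 : ℝ) ≤ ℓ i := fun i => by exact_mod_cast h.one_le i
  have hτ2 : τ < π / 2 := by nlinarith [hone 0, hℓ 0]
  have hcos : 0 < cos τ := cos_pos_of_mem_Ioo ⟨by linarith [pi_pos], hτ2⟩
  have hsin : 0 < sin (2 * τ) := sin_pos_of_pos_of_lt_pi (by linarith) (by linarith)
  have htan := one_sub_cos_two_mul hcos.ne'
  set ε : ℝ := (-1) ^ ℓ 0 with hε
  have hεε : ε * ε = 1 := by rw [hε, ← mul_pow]; simp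
  set α := x (P 0 0) with hα
  -- In terms of `s`, the value at the second end is `β` on the first two paths, `-β` on the third.
  set β := ε * x (P 0 (ℓ 0)) with hβ
  have hs0 : ∀ i, s i 0 = α := fun i => by simp only [hs]; rw [h.start_eq i 0]; simp [hα]
  have hsl0 : s 0 (ℓ 0) = β := rfl
  have hsl1 : s 1 (ℓ 1) = β := by
    simp only [hs]; rw [h.end_eq 1 0, neg_one_pow_eq_of_mod hab.symm]
  have hsl2 : s 2 (ℓ 2) = -β := by
    simp only [hs]; rw [h.end_eq 2 0, neg_one_pow_eq_neg_of_mod hc, neg_mul]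
  have hpen : ∀ i, (-1) ^ ℓ i * x (P i (ℓ i - 1)) = -s i (ℓ i - 1) := by
    intro i
    simp only [hs]
    obtain ⟨m, hm⟩ := Nat.exists_eq_add_of_le (h.one_le i)
    rw [hm, Nat.add_sub_cancel_left, pow_add, pow_one]
    ring
  have hpen0 := hpen 0
  have hpen1 := hpen 1
  have hpen2 := hpen 2
  rw [neg_one_pow_eq_of_mod hab.symm] at hpen1
  rw [neg_one_pow_eq_neg_of_mod hc] at hpen2
  have hstart := hx (P 0 0)
  rw [h.signlessAction_start] at hstart
  have hs1 : ∀ i, s i 1 = -x (P i 1) := fun i => by simp [hs]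
  have hend := hx (P 0 (ℓ 0))
  rw [h.signlessAction_end] at hend
  have hS : 3 * α - (s 0 1 + s 1 1 + s 2 1) = (2 - 2 * cos (2 * τ)) * α := by
    rw [hs1, hs1, hs1]; linarith
  have hE : 3 * β - (s 0 (ℓ 0 - 1) + s 1 (ℓ 1 - 1) - s 2 (ℓ 2 - 1))
      = (2 - 2 * cos (2 * τ)) * β := by
    linear_combination ε * hend - hpen0 - hpen1 + hpen2
  obtain ⟨p0, m0⟩ := add_of_recurrence (h.one_le 0) (hrec 0) hτ (hℓ 0)
  obtain ⟨p1, m1⟩ := add_of_recurrence (h.one_le 1) (hrec 1) hτ (hℓ 1)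
  obtain ⟨p2, m2⟩ := add_of_recurrence (h.one_le 2) (hrec 2) hτ (hℓ 2)
  rw [hs0, hsl0] at p0 m0
  rw [hs0, hsl1] at p1 m1
  rw [hs0, hsl2] at p2 m2
  by_contra! hne
  have hsum : α + β = 0 := by
    have : (α + β) * (sin (2 * τ) * symmChar (ℓ 0) (ℓ 1) (ℓ 2) τ) = 0 := by
      unfold symmChar
      linear_combination (-1) * hS - hE - p0 - p1 - m2 + (α + β) * htan
    rcases mul_eq_zero.1 this with e | e
    · exact e
    · exact absurd e (mul_ne_zero hsin.ne' hne.1)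
  have hdiff : α - β = 0 := by
    have : (α - β) * (sin (2 * τ) * antisymmChar (ℓ 0) (ℓ 1) (ℓ 2) τ) = 0 := by
      unfold antisymmChar
      linear_combination (-1) * hS + hE - m0 - m1 - p2 + (α - β) * htan
    rcases mul_eq_zero.1 this with e | e
    · exact e
    · exact absurd e (mul_ne_zero hsin.ne' hne.2)
  have hα0 : α = 0 := by linarith
  have hβ0 : β = 0 := by linarith
  have hend0 : ∀ i, s i (ℓ i) = 0 := by
    intro i
    fin_cases i
    · exact hsl0.trans hβ0
    · exact hsl1.trans hβ0
    · exact hsl2.trans (by rw [hβ0, neg_zero])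
  have hzero : ∀ i k, k ≤ ℓ i → s i k = 0 := by
    intro i k hk
    have h1 := mul_sin_of_recurrence (hrec i) _ le_rfl
    rw [hend0, hs0, hα0, zero_mul, zero_mul, sub_zero] at h1
    have h2 : 0 < sin (ℓ i * (2 * τ)) :=
      sin_pos_of_pos_of_lt_pi (by nlinarith [hone i]) (by linarith [hℓ i])
    have h3 : s i 1 = 0 := by
      rcases mul_eq_zero.1 h1.symm with e | e
      · exact e
      · exact absurd e h2.ne'
    have h4 := mul_sin_of_recurrence (hrec i) _ hk
    rw [h3, hs0, hα0, zero_mul, zero_mul, sub_zero] at h4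
    rcases mul_eq_zero.1 h4 with e | e
    · exact e
    · exact absurd e hsin.ne'
  apply hx0
  ext w
  obtain ⟨i, k, hk, rfl⟩ := h.cover w
  have := hzero i k hk
  simpa [hs] using this

/-- The explicit test function: on the paths it solves the eigenvalue equation for `4 sin² τ`, so
that only the two ends contribute to the Rayleigh quotient. -/
theorem rayleigh_bound (h : ThetaModel G ℓ P) (hab : ℓ 0 % 2 = ℓ 1 % 2) (hc : ℓ 2 % 2 ≠ ℓ 0 % 2)
    {τ : ℝ} (hτ : 0 < τ) (hℓ : ∀ i, ℓ i * τ < π / 2) :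
    ∃ S : ℝ, 0 < S ∧ (leastQEigenvalue G - (2 - 2 * cos (2 * τ))) * S
      ≤ -(2 * sin (2 * τ) * symmChar (ℓ 0) (ℓ 1) (ℓ 2) τ) := by
  classical
  have hone : ∀ i, (1 : ℝ) ≤ ℓ i := fun i => by exact_mod_cast h.one_le i
  have hτ2 : τ < π / 2 := by nlinarith [hone 0, hℓ 0]
  have hcos : 0 < cos τ := cos_pos_of_mem_Ioo ⟨by linarith [pi_pos], hτ2⟩
  have htan := one_sub_cos_two_mul hcos.ne'
  have hpos : ∀ i, 0 < ℓ i * τ := fun i => by nlinarith [hone i]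
  have hS : ∀ i, 0 < sin (ℓ i * τ) := fun i =>
    sin_pos_of_pos_of_lt_pi (hpos i) (by linarith [pi_pos, hℓ i])
  have hC : ∀ i, 0 < cos (ℓ i * τ) := fun i =>
    cos_pos_of_mem_Ioo ⟨by linarith [pi_pos, hpos i], hℓ i⟩
  -- After removing alternating signs, the solution is even about the midpoint on the first two
  -- paths and odd on the third, with value `1` at the first end.
  set Y : Fin 3 → ℕ → ℝ := fun i k => (-1) ^ k *
    (if i = 2 then sin (ℓ i * τ - k * (2 * τ)) / sin (ℓ i * τ)
      else cos (ℓ i * τ - k * (2 * τ)) / cos (ℓ i * τ)) with hY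
  have hY0 : ∀ i, Y i 0 = 1 := by
    intro i
    simp only [hY]
    split_ifs
    · simp [(hS i).ne']
    · simp [(hC i).ne']
  set ε : ℝ := (-1) ^ ℓ 0 with hε
  have hεε : ε * ε = 1 := by rw [hε, ← mul_pow]; simp
  have hε1 : (-1 : ℝ) ^ ℓ 1 = ε := neg_one_pow_eq_of_mod hab.symm
  have hε2 : (-1 : ℝ) ^ ℓ 2 = -ε := neg_one_pow_eq_neg_of_mod hc
  have hrefl : ∀ i, (ℓ i : ℝ) * τ - ℓ i * (2 * τ) = -(ℓ i * τ) := fun i => by ring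
  have hYl : ∀ i, Y i (ℓ i) = ε := by
    intro i
    simp only [hY, hrefl]
    fin_cases i
    · simp [(hC 0).ne', hε]
    · simp [(hC 1).ne', hε1]
    · simp [(hS 2).ne', hε2]
  obtain ⟨y, hy⟩ := h.exists_lift Y (fun i j => by rw [hY0, hY0]) (fun i j => by rw [hYl, hYl])
  have hint : ∀ i k, k + 1 < ℓ i →
      signlessAction G y (P i (k + 1)) = (2 - 2 * cos (2 * τ)) * y (P i (k + 1)) := by
    intro i k hk
    rw [h.signlessAction_interior y i k hk, hy i _ (by omega), hy i _ (by omega),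
      hy i _ (by omega)]
    have e1 : (ℓ i : ℝ) * τ - k * (2 * τ) = (ℓ i * τ - (k + 1) * (2 * τ)) + 2 * τ := by ring
    have e2 : (ℓ i : ℝ) * τ - (k + 2) * (2 * τ) = (ℓ i * τ - (k + 1) * (2 * τ)) - 2 * τ := by ring
    simp only [hY]
    push_cast
    rw [e1, e2]
    generalize (ℓ i : ℝ) * τ - (k + 1) * (2 * τ) = φ
    split_ifs
    · rw [sin_add, sin_sub]; ring
    · rw [cos_add, cos_sub]; ring
  have hT : ∀ i, cos (ℓ i * τ - 2 * τ) / cos (ℓ i * τ)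
      = cos (2 * τ) + sin (2 * τ) * tan (ℓ i * τ) := by
    intro i
    have := (hC i).ne'
    rw [cos_sub, tan_eq_sin_div_cos]
    field_simp
  have hT2 : ∀ i, sin (ℓ i * τ - 2 * τ) / sin (ℓ i * τ)
      = cos (2 * τ) - sin (2 * τ) * (tan (ℓ i * τ))⁻¹ := by
    intro i
    have := (hS i).ne'
    rw [sin_sub, tan_eq_sin_div_cos, inv_div]
    field_simp
  set F := symmChar (ℓ 0) (ℓ 1) (ℓ 2) τ with hF
  have hstart : signlessAction G y (P 0 0)
      = (2 - 2 * cos (2 * τ)) * y (P 0 0) - sin (2 * τ) * F := by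
    rw [h.signlessAction_start, hy 0 0 (by omega), hy 0 1 (h.one_le _), hy 1 1 (h.one_le _),
      hy 2 1 (h.one_le _), hY0]
    have e0 : Y 0 1 = -(cos (2 * τ) + sin (2 * τ) * tan (ℓ 0 * τ)) := by
      rw [← hT]; simp [hY]
    have e1 : Y 1 1 = -(cos (2 * τ) + sin (2 * τ) * tan (ℓ 1 * τ)) := by
      rw [← hT]; simp [hY]
    have e2 : Y 2 1 = -(cos (2 * τ) - sin (2 * τ) * (tan (ℓ 2 * τ))⁻¹) := by
      rw [← hT2]; simp [hY]
    rw [e0, e1, e2, hF, symmChar]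
    linear_combination htan
  have hend : signlessAction G y (P 0 (ℓ 0))
      = (2 - 2 * cos (2 * τ)) * y (P 0 (ℓ 0)) - ε * (sin (2 * τ) * F) := by
    rw [h.signlessAction_end, hy 0 _ le_rfl, hy 0 _ (Nat.sub_le _ _), hy 1 _ (Nat.sub_le _ _),
      hy 2 _ (Nat.sub_le _ _), hYl]
    have hpow : ∀ i, (-1 : ℝ) ^ (ℓ i - 1) = -(-1) ^ ℓ i := by
      intro i
      obtain ⟨m, hm⟩ := Nat.exists_eq_add_of_le (h.one_le i)
      rw [hm, Nat.add_sub_cancel_left, pow_add, pow_one]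
      ring
    have harg : ∀ i, (ℓ i : ℝ) * τ - ((ℓ i - 1 : ℕ) : ℝ) * (2 * τ) = -(ℓ i * τ - 2 * τ) := by
      intro i
      rw [Nat.cast_sub (h.one_le i)]
      push_cast
      ring
    have e0 : Y 0 (ℓ 0 - 1) = -ε * (cos (2 * τ) + sin (2 * τ) * tan (ℓ 0 * τ)) := by
      rw [← hT]; simp only [hY, hpow, harg, cos_neg]; simp [hε]
    have e1 : Y 1 (ℓ 1 - 1) = -ε * (cos (2 * τ) + sin (2 * τ) * tan (ℓ 1 * τ)) := by
      rw [← hT]; simp only [hY, hpow, harg, cos_neg]; simp [hε1]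
    have e2 : Y 2 (ℓ 2 - 1) = -ε * (cos (2 * τ) - sin (2 * τ) * (tan (ℓ 2 * τ))⁻¹) := by
      rw [← hT2]; simp only [hY, hpow, harg, sin_neg]; simp [hε2, neg_div]
    rw [e0, e1, e2, hF, symmChar]
    linear_combination ε * htan
  have hy0 : y (P 0 0) = 1 := by rw [hy 0 0 (by omega), hY0]
  have hyl : y (P 0 (ℓ 0)) = ε := by rw [hy 0 _ le_rfl, hYl]
  have hsum : ∑ w, (y w * signlessAction G y w - (2 - 2 * cos (2 * τ)) * y w ^ 2)
      = -(2 * sin (2 * τ) * F) := by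
    rw [Finset.sum_eq_add (P 0 0) (P 0 (ℓ 0)) (h.start_ne_end 0 0)]
    · rw [hstart, hend, hy0, hyl]
      linear_combination (-sin (2 * τ) * F) * hεε
    · rintro w - ⟨hw1, hw2⟩
      obtain ⟨i, k, hk, rfl⟩ := h.cover w
      have hk0 : k ≠ 0 := by
        rintro rfl
        exact hw1 (h.start_eq _ _)
      have hkl : k ≠ ℓ i := by
        rintro rfl
        exact hw2 (h.end_eq _ _)
      obtain ⟨k, rfl⟩ := Nat.exists_eq_succ_of_ne_zero hk0
      rw [Nat.succ_eq_add_one, hint i k (by omega)]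
      ring
    · simp
    · simp
  rw [Finset.sum_sub_distrib, ← Finset.mul_sum] at hsum
  have : Nonempty V := ⟨P 0 0⟩
  refine ⟨∑ w, y w ^ 2, ?_, ?_⟩
  · refine lt_of_lt_of_le ?_
      (Finset.single_le_sum (fun w _ => sq_nonneg (y w)) (Finset.mem_univ (P 0 0)))
    rw [hy0]
    norm_num
  · have := leastQEigenvalue_mul_sum_sq_le G y
    linarith

theorem leastQEigenvalue_lt (h : ThetaModel G ℓ P) (hab : ℓ 0 % 2 = ℓ 1 % 2)
    (hc : ℓ 2 % 2 ≠ ℓ 0 % 2) {τ : ℝ} (hτ : 0 < τ) (hℓ : ∀ i, ℓ i * τ < π / 2)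
    (hF : 0 < symmChar (ℓ 0) (ℓ 1) (ℓ 2) τ) : leastQEigenvalue G < 2 - 2 * cos (2 * τ) := by
  obtain ⟨S, hS, hle⟩ := h.rayleigh_bound hab hc hτ hℓ
  have hone : (1 : ℝ) ≤ ℓ 0 := by exact_mod_cast h.one_le 0
  have hsin : 0 < sin (2 * τ) :=
    sin_pos_of_pos_of_lt_pi (by linarith) (by nlinarith [hℓ 0])
  have : 0 < 2 * sin (2 * τ) * symmChar (ℓ 0) (ℓ 1) (ℓ 2) τ := by positivity
  by_contra hge
  have := mul_nonneg (sub_nonneg.2 (not_lt.1 hge)) hS.le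
  linarith

end ThetaModel

end ThetaQ

/-! ### Trigonometric inequalities -/

namespace ThetaQ

open Real

theorem tan_sub_tan_eq {x y : ℝ} (hx : cos x ≠ 0) (hy : cos y ≠ 0) :
    tan x - tan y = sin (x - y) / (cos x * cos y) := by
  rw [tan_eq_sin_div_cos, tan_eq_sin_div_cos, sin_sub]
  field_simp

/-- Strict convexity of the tangent: spreading two arguments apart increases the sum. -/
theorem tan_add_tan_lt {x y z : ℝ} (hz : 0 < z) (hzx : z < x) (hzy : z < y)
    (hxy : x + y - z < π / 2) : tan x + tan y < tan z + tan (x + y - z) := by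
  have hcos : ∀ w, 0 < w → w ≤ x + y - z → 0 < cos w := fun w h0 h1 =>
    cos_pos_of_mem_Ioo ⟨by linarith [pi_pos], by linarith⟩
  have cx := hcos x (by linarith) (by linarith)
  have cy := hcos y (by linarith) (by linarith)
  have cz := hcos z (by linarith) (by linarith)
  have cw := hcos (x + y - z) (by linarith) le_rfl
  have h1 := tan_sub_tan_eq cx.ne' cz.ne'
  have h2 := tan_sub_tan_eq cw.ne' cy.ne'
  rw [show x + y - z - y = x - z by ring] at h2
  have hs : 0 < sin (x - z) := sin_pos_of_pos_of_lt_pi (by linarith) (by linarith [pi_pos])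
  have h3 : cos (x + y - z) < cos x :=
    cos_lt_cos_of_nonneg_of_le_pi_div_two (by linarith) hxy.le (by linarith)
  have h4 : cos y < cos z :=
    cos_lt_cos_of_nonneg_of_le_pi_div_two (by linarith) (by linarith) hzy
  have h5 : sin (x - z) / (cos x * cos z) < sin (x - z) / (cos (x + y - z) * cos y) :=
    div_lt_div_of_pos_left hs (by positivity) (mul_lt_mul'' h3 h4 cw.le cy.le)
  linarith

theorem tan_add_tan_le {x y z : ℝ} (hz : 0 < z) (hzx : z ≤ x) (hzy : z ≤ y)
    (hxy : x + y - z < π / 2) : tan x + tan y ≤ tan z + tan (x + y - z) := by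
  rcases hzx.eq_or_lt with rfl | hzx
  · rw [add_sub_cancel_left]
  rcases hzy.eq_or_lt with rfl | hzy
  · rw [add_sub_cancel_right, add_comm]
  exact (tan_add_tan_lt hz hzx hzy hxy).le

theorem tan_le_inv_tan {x y : ℝ} (hx : 0 < x) (hy : 0 < y) (hxy : x + y ≤ π / 2) :
    tan x ≤ (tan y)⁻¹ := by
  rw [← tan_pi_div_two_sub]
  exact strictMonoOn_tan.monotoneOn ⟨by linarith, by linarith⟩ ⟨by linarith, by linarith⟩
    (by linarith)

theorem tan_lt_inv_tan {x y : ℝ} (hx : 0 < x) (hy : 0 < y) (hxy : x + y < π / 2) :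
    tan x < (tan y)⁻¹ := by
  rw [← tan_pi_div_two_sub]
  exact strictMonoOn_tan ⟨by linarith, by linarith⟩ ⟨by linarith, by linarith⟩ (by linarith)

theorem tan_sub_inv_tan_eq {x y : ℝ} (hx : cos x ≠ 0) (hy : sin y ≠ 0) :
    tan x - (tan y)⁻¹ = -(cos (x + y) / (cos x * sin y)) := by
  rw [tan_eq_sin_div_cos, tan_eq_sin_div_cos, inv_div, cos_add]
  field_simp
  ring

/-- For fixed `x + y < π / 2`, the difference `tan x - cot y` decreases in `x`: it equals
`-cos (x + y) / (cos x * sin y)`, and the denominator decreases in `x`. -/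
theorem tan_sub_inv_tan_lt {x y z w : ℝ} (hz : 0 < z) (hzx : z < x) (hy : 0 < y)
    (hsum : x + y = z + w) (hlt : x + y < π / 2) :
    tan x - (tan y)⁻¹ < tan z - (tan w)⁻¹ := by
  have hpi := pi_pos
  have hcos : ∀ u, 0 < u → u < π / 2 → 0 < cos u := fun u h0 h1 =>
    cos_pos_of_mem_Ioo ⟨by linarith, h1⟩
  have hsin : ∀ u, 0 < u → u < π / 2 → 0 < sin u := fun u h0 h1 =>
    sin_pos_of_pos_of_lt_pi h0 (by linarith)
  have cx := hcos x (by linarith) (by linarith)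
  have cz := hcos z (by linarith) (by linarith)
  have sy := hsin y hy (by linarith)
  have sw := hsin w (by linarith) (by linarith)
  have cs := hcos (x + y) (by linarith) hlt
  rw [tan_sub_inv_tan_eq cx.ne' sy.ne', tan_sub_inv_tan_eq cz.ne' sw.ne', ← hsum, neg_lt_neg_iff]
  refine div_lt_div_of_pos_left cs (by positivity) ?_
  have e1 : 2 * (cos x * sin y) = sin (x + y) - sin (x - y) := by rw [sin_add, sin_sub]; ring
  have e2 : 2 * (cos z * sin w) = sin (z + w) - sin (z - w) := by rw [sin_add, sin_sub]; ring
  have h3 : sin (z - w) < sin (x - y) :=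
    sin_lt_sin_of_lt_of_le_pi_div_two (by linarith) (by linarith) (by linarith)
  rw [← hsum] at e2
  linarith

/-- A positive number up to `2 - 2 cos θ` is `2 - 2 cos (2 τ)` for some `τ` in `(0, θ / 2]`. -/
theorem exists_angle {q θ : ℝ} (hq : 0 < q) (hθ0 : 0 ≤ θ) (hθ : θ ≤ π)
    (hqθ : q ≤ 2 - 2 * cos θ) : ∃ τ, 0 < τ ∧ 2 * τ ≤ θ ∧ q = 2 - 2 * cos (2 * τ) := by
  have h1 : cos θ ≤ 1 - q / 2 := by linarith
  refine ⟨arccos (1 - q / 2) / 2, ?_, ?_, ?_⟩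
  · have := arccos_pos.2 (show 1 - q / 2 < 1 by linarith)
    linarith
  · have := antitone_arccos h1
    rw [arccos_cos hθ0 hθ] at this
    linarith
  · rw [mul_div_cancel₀ _ (two_ne_zero), cos_arccos]
    · ring
    · linarith [neg_one_le_cos θ]
    · linarith

theorem antisymmChar_neg {a b c : ℕ} {τ : ℝ} (ha : 1 ≤ a) (hb : 1 ≤ b) (hc : 1 ≤ c) (hτ : 0 < τ)
    (hbτ : b * τ < π / 2) (hac : (a + c : ℕ) * τ ≤ π / 2) : antisymmChar a b c τ < 0 := by
  have ha' : (1 : ℝ) ≤ a := by exact_mod_cast ha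
  have hb' : (1 : ℝ) ≤ b := by exact_mod_cast hb
  have hc' : (1 : ℝ) ≤ c := by exact_mod_cast hc
  push_cast at hac
  have h1 : tan (c * τ) ≤ (tan (a * τ))⁻¹ :=
    tan_le_inv_tan (by positivity) (by positivity) (by linarith)
  have h2 : 0 < (tan (b * τ))⁻¹ := inv_pos.2 (tan_pos_of_pos_of_lt_pi_div_two (by positivity) hbτ)
  have h3 : 0 < tan τ := tan_pos_of_pos_of_lt_pi_div_two hτ (by nlinarith)
  unfold antisymmChar
  linarith

/-- Concentrating the lengths `a`, `b` into `1`, `a + b - 1` increases the characteristic function;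
for `1`, `a + b - 1` the term `-tan τ` cancels. -/
theorem symmChar_le {a b c : ℕ} {τ : ℝ} (ha : 1 ≤ a) (hb : 1 ≤ b) (hc : 1 ≤ c) (hτ : 0 < τ)
    (hn : ((a : ℝ) + b + c - 1) * τ ≤ π / 2) :
    symmChar a b c τ ≤ tan ((a + b - 1) * τ) - (tan (c * τ))⁻¹ ∧
    (1 < a → 1 < b → symmChar a b c τ < tan ((a + b - 1) * τ) - (tan (c * τ))⁻¹) := by
  have ha' : (1 : ℝ) ≤ a := by exact_mod_cast ha
  have hb' : (1 : ℝ) ≤ b := by exact_mod_cast hb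
  have hc' : (1 : ℝ) ≤ c := by exact_mod_cast hc
  have hlt : a * τ + b * τ - τ < π / 2 := by nlinarith
  unfold symmChar
  rw [show ((a : ℝ) + b - 1) * τ = a * τ + b * τ - τ by ring]
  refine ⟨?_, fun h1 h2 => ?_⟩
  · have := tan_add_tan_le hτ (show τ ≤ a * τ by nlinarith) (show τ ≤ b * τ by nlinarith) hlt
    linarith
  · have h1' : (1 : ℝ) < a := by exact_mod_cast h1
    have h2' : (1 : ℝ) < b := by exact_mod_cast h2
    have := tan_add_tan_lt hτ (show τ < a * τ by nlinarith) (show τ < b * τ by nlinarith) hlt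
    linarith

theorem symmChar_neg_of_lt {a b c : ℕ} {τ : ℝ} (ha : 1 ≤ a) (hb : 1 ≤ b) (hc : 1 ≤ c) (hτ : 0 < τ)
    (hn : ((a : ℝ) + b + c - 1) * τ < π / 2) : symmChar a b c τ < 0 := by
  have ha' : (1 : ℝ) ≤ a := by exact_mod_cast ha
  have hb' : (1 : ℝ) ≤ b := by exact_mod_cast hb
  have hc' : (1 : ℝ) ≤ c := by exact_mod_cast hc
  have h1 := (symmChar_le ha hb hc hτ hn.le).1
  have h2 : tan ((a + b - 1) * τ) < (tan (c * τ))⁻¹ :=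
    tan_lt_inv_tan (by nlinarith) (by positivity) (by linarith)
  linarith

theorem symmChar_neg_of_one_lt {a b c : ℕ} {τ : ℝ} (ha : 1 < a) (hb : 1 < b) (hc : 1 ≤ c)
    (hτ : 0 < τ) (hn : ((a : ℝ) + b + c - 1) * τ ≤ π / 2) : symmChar a b c τ < 0 := by
  have ha' : (1 : ℝ) < a := by exact_mod_cast ha
  have hb' : (1 : ℝ) < b := by exact_mod_cast hb
  have hc' : (1 : ℝ) ≤ c := by exact_mod_cast hc
  have h1 := (symmChar_le ha.le hb.le hc hτ hn).2 ha hb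
  have h2 : tan ((a + b - 1) * τ) ≤ (tan (c * τ))⁻¹ :=
    tan_le_inv_tan (by nlinarith) (by positivity) (by linarith)
  linarith

/-- Among even lengths of the first two paths, `2, 2` maximizes the characteristic function. -/
theorem symmChar_lt_symmChar_two_two {a b c d : ℕ} {τ : ℝ} (ha : 2 ≤ a) (hb : 2 ≤ b) (hc : 1 ≤ c)
    (hab : 4 < a + b) (hd : a + b + c = 4 + d) (hτ : 0 < τ) (hn : (d + 2 : ℕ) * τ < π / 2) :
    symmChar a b c τ < symmChar 2 2 d τ := by
  have ha' : (2 : ℝ) ≤ a := by exact_mod_cast ha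
  have hb' : (2 : ℝ) ≤ b := by exact_mod_cast hb
  have hc' : (1 : ℝ) ≤ c := by exact_mod_cast hc
  have hab' : (4 : ℝ) < a + b := by exact_mod_cast hab
  have hd' : (a : ℝ) + b + c = 4 + d := by exact_mod_cast hd
  push_cast at hn
  have hsum : a * τ + b * τ - 2 * τ + c * τ = 2 * τ + d * τ := by linear_combination τ * hd'
  have hcpos : 0 < c * τ := by positivity
  have h1 : tan (a * τ) + tan (b * τ) ≤ tan (2 * τ) + tan (a * τ + b * τ - 2 * τ) :=
    tan_add_tan_le (by positivity) (by nlinarith) (by nlinarith) (by linarith)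
  have h2 : tan (a * τ + b * τ - 2 * τ) - (tan (c * τ))⁻¹ < tan (2 * τ) - (tan (d * τ))⁻¹ :=
    tan_sub_inv_tan_lt (by positivity) (by nlinarith) hcpos hsum (by linarith)
  unfold symmChar
  push_cast
  linarith

/-! ### Bounds for the least eigenvalue -/

namespace ThetaModel

variable {V W : Type*} [Fintype V] [Fintype W] {G : SimpleGraph V} {H : SimpleGraph W}
  {ℓ : Fin 3 → ℕ} {P : Fin 3 → ℕ → V} {R : Fin 3 → ℕ → W}

theorem length_add_two_le (h : ThetaModel G ℓ P) (i : Fin 3) : ℓ i + 2 ≤ Fintype.card V := by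
  have h1 := h.card_add_one
  have h01 := h.three_le 0 1 (by decide)
  have h02 := h.three_le 0 2 (by decide)
  have h12 := h.three_le 1 2 (by decide)
  fin_cases i <;> simp <;> omega

/-- In the range `N τ ≤ π / 2`, where `N` is at least `ℓ 0 + ℓ 2` and exceeds every length, only the
symmetric characteristic equation is relevant. -/
theorem symmChar_eq_zero (h : ThetaModel G ℓ P) (hab : ℓ 0 % 2 = ℓ 1 % 2)
    (hc : ℓ 2 % 2 ≠ ℓ 0 % 2) {τ : ℝ} (hτ : 0 < τ) {N : ℕ} (hN : N * τ ≤ π / 2)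
    (hlN : ∀ i, ℓ i < N) (hacN : ℓ 0 + ℓ 2 ≤ N)
    (hq : leastQEigenvalue G = 2 - 2 * cos (2 * τ)) : symmChar (ℓ 0) (ℓ 1) (ℓ 2) τ = 0 := by
  have : Nonempty V := ⟨P 0 0⟩
  have hℓ : ∀ i, ℓ i * τ < π / 2 := fun i => by
    have : (ℓ i : ℝ) < N := by exact_mod_cast hlN i
    nlinarith
  obtain ⟨x, hx0, hx⟩ := exists_eigenfunction_leastQEigenvalue G
  refine (h.char_eq_zero hab hc hτ hℓ hx0 fun w => by rw [hx, hq]).resolve_right ?_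
  refine (antisymmChar_neg (h.one_le 0) (h.one_le 1) (h.one_le 2) hτ (hℓ 1) ?_).ne
  have : ((ℓ 0 + ℓ 2 : ℕ) : ℝ) ≤ N := by exact_mod_cast hacN
  nlinarith

theorem leastQEigenvalue_pos (h : ThetaModel G ℓ P) (hc : ℓ 2 % 2 ≠ ℓ 0 % 2) :
    0 < leastQEigenvalue G := by
  have : Nonempty V := ⟨P 0 0⟩
  obtain ⟨x, hx0, hx⟩ := exists_eigenfunction_leastQEigenvalue G
  exact h.eigenvalue_pos hc hx0 hx

/-- The least eigenvalue of a nonbipartite θ-graph of order `n` is at least `2 - 2 cos (π / n)`,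
with equality only if one of the two paths of equal parity is a single edge. -/
theorem two_sub_le_leastQEigenvalue (h : ThetaModel G ℓ P) (hab : ℓ 0 % 2 = ℓ 1 % 2)
    (hc : ℓ 2 % 2 ≠ ℓ 0 % 2) :
    2 - 2 * cos (π / Fintype.card V) ≤ leastQEigenvalue G ∧
    (leastQEigenvalue G = 2 - 2 * cos (π / Fintype.card V) → ℓ 0 = 1 ∨ ℓ 1 = 1) := by
  set n := Fintype.card V with hn
  have hcard := h.card_add_one
  have hcard' : (ℓ 0 : ℝ) + ℓ 1 + ℓ 2 - 1 = n := by
    have : (n : ℝ) + 1 = ℓ 0 + ℓ 1 + ℓ 2 := by exact_mod_cast hcard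
    linarith
  have hln := h.length_add_two_le
  have hn2 : 1 ≤ n := by have := hln 0; omega
  have hn0 : (1 : ℝ) ≤ n := by exact_mod_cast hn2
  have hpi := pi_pos
  have hpos := h.leastQEigenvalue_pos hc
  have hτn : ∀ τ : ℝ, 2 * τ ≤ π / n → n * τ ≤ π / 2 := by
    intro τ hτ
    rw [le_div_iff₀ (by positivity)] at hτ
    linarith
  have key : ∀ τ, 0 < τ → 2 * τ ≤ π / n → leastQEigenvalue G = 2 - 2 * cos (2 * τ) →
      symmChar (ℓ 0) (ℓ 1) (ℓ 2) τ = 0 := fun τ h0 h1 h2 =>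
    h.symmChar_eq_zero hab hc h0 (hτn τ h1) (fun i => by have := hln i; omega)
      (by have := h.one_le 1; omega) h2
  have hpin : π / n ≤ π := div_le_self hpi.le hn0
  constructor
  · by_contra! hlt
    obtain ⟨τ, h0, h1, h2⟩ := exists_angle hpos (by positivity) hpin hlt.le
    have hne : 2 * τ ≠ π / n := by
      intro e
      rw [h2, e] at hlt
      exact lt_irrefl _ hlt
    have hlt' : (n : ℝ) * τ < π / 2 := by
      have := lt_of_le_of_ne h1 hne
      rw [lt_div_iff₀ (by positivity)] at this
      linarith
    exact (symmChar_neg_of_lt (h.one_le 0) (h.one_le 1) (h.one_le 2) h0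
      (by rwa [hcard'])).ne (key τ h0 h1 h2)
  · intro he
    obtain ⟨τ, h0, h1, h2⟩ := exists_angle hpos (by positivity) hpin he.le
    by_contra! hne
    have := h.one_le 0
    have := h.one_le 1
    exact (symmChar_neg_of_one_lt (show 1 < ℓ 0 by omega) (show 1 < ℓ 1 by omega) (h.one_le 2) h0
      (by rw [hcard']; exact hτn τ h1)).ne (key τ h0 h1 h2)

/-- An upper bound for the θ-graph with path lengths `2, 2, d`, of order `d + 3`. It bounds
the range of angles in which other θ-graphs have to be compared with it. -/
theorem leastQEigenvalue_two_two_lt (h : ThetaModel H ℓ R) (h0 : ℓ 0 = 2) (h1 : ℓ 1 = 2)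
    (hc : ℓ 2 % 2 = 1) : leastQEigenvalue H < 2 - 2 * cos (π / (ℓ 2 + 2 : ℕ)) := by
  have hpi := pi_pos
  set d := ℓ 2 with hd
  have hd1 : (1 : ℝ) ≤ d := by exact_mod_cast h.one_le 2
  -- At this angle the terms `tan (2 τ)` and `cot (d τ)` cancel, and `tan (2 τ) - tan τ` remains.
  set τ : ℝ := π / (2 * (d + 2)) with hτ
  have hτ0 : 0 < τ := by positivity
  have hdτ : (d + 2) * τ = π / 2 := by rw [hτ]; field_simp
  have e : π / (d + 2 : ℕ) = 2 * τ := by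
    push_cast
    rw [hτ]
    field_simp
  rw [e]
  refine h.leastQEigenvalue_lt (by omega) (by omega) hτ0 ?_ ?_
  · intro i
    fin_cases i
    · simp only [Fin.zero_eta, h0]; push_cast; nlinarith
    · simp only [Fin.mk_one, h1]; push_cast; nlinarith
    · simp only [Fin.reduceFinMk, ← hd]; nlinarith
  · unfold symmChar
    rw [h0, h1, ← tan_pi_div_two_sub]
    have e2 : π / 2 - ((ℓ 2 : ℕ) : ℝ) * τ = 2 * τ := by rw [← hd]; linarith
    have : tan τ < tan (2 * τ) :=
      strictMonoOn_tan ⟨by linarith, by nlinarith⟩ ⟨by linarith, by nlinarith⟩ (by linarith)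
    rw [e2]
    push_cast
    linarith

/-- If the two paths of equal parity have even length, the least eigenvalue is at most that of the
θ-graph of the same order with path lengths `2, 2, d` only for these lengths: an angle of `G` makes
the test function of `H` strictly better. -/
theorem lengths_eq_of_le (h : ThetaModel G ℓ P) {m : Fin 3 → ℕ} (h' : ThetaModel H m R)
    (hm0 : m 0 = 2) (hm1 : m 1 = 2) (hm2 : m 2 % 2 = 1) (hsum : ℓ 0 + ℓ 1 + ℓ 2 = 4 + m 2)
    (ha : ℓ 0 % 2 = 0) (hb : ℓ 1 % 2 = 0) (hc : ℓ 2 % 2 = 1)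
    (hle : leastQEigenvalue G ≤ leastQEigenvalue H) : ℓ = m := by
  have hpi := pi_pos
  have hlt := h'.leastQEigenvalue_two_two_lt hm0 hm1 hm2
  set d := m 2 with hd
  have hd1 : (1 : ℝ) ≤ d := by exact_mod_cast h'.one_le 2
  have hd0 : (0 : ℝ) < (d + 2 : ℕ) := by push_cast; linarith
  have hpos := h.leastQEigenvalue_pos (by omega)
  have hpin : π / (d + 2 : ℕ) ≤ π := div_le_self hpi.le (by push_cast; linarith)
  have i0 := h.one_le 0
  have i1 := h.one_le 1
  have i2 := h.one_le 2
  obtain ⟨τ, h0, h1, h2⟩ := exists_angle hpos (by positivity) hpin (hle.trans hlt.le)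
  have hne : 2 * τ ≠ π / (d + 2 : ℕ) := by
    intro e
    rw [← e, ← h2] at hlt
    exact absurd hlt (not_lt.2 hle)
  have hτ : (d + 2 : ℕ) * τ < π / 2 := by
    have := lt_of_le_of_ne h1 hne
    rw [lt_div_iff₀ hd0] at this
    linarith
  have hzero := h.symmChar_eq_zero (by omega) (by omega) h0 hτ.le
    (by intro i; fin_cases i <;> simp <;> omega) (by omega) h2
  by_cases h4 : 4 < ℓ 0 + ℓ 1
  · exfalso
    have h5 := symmChar_lt_symmChar_two_two (by omega) (by omega) i2 h4 hsum h0 hτ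
    rw [hzero] at h5
    push_cast at hτ
    have h6 := h'.leastQEigenvalue_lt (by omega) (by omega) h0 (by
      intro i
      fin_cases i
      · simp only [Fin.zero_eta, hm0]; push_cast; nlinarith
      · simp only [Fin.mk_one, hm1]; push_cast; nlinarith
      · simp only [Fin.reduceFinMk, ← hd]; nlinarith) (by rwa [hm0, hm1])
    rw [← h2] at h6
    exact absurd h6 (not_lt.2 hle)
  · ext i
    fin_cases i <;> simp <;> omega

end ThetaModel

end ThetaQ

/-! ### The extremal graphs -/

namespace ThetaQ

open Real

theorem cycleGraph_adj_iff {n : ℕ} (hn : 3 ≤ n) (a b : Fin n) :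
    (SimpleGraph.cycleGraph n).Adj a b ↔ (a : ℕ) + 1 = b ∨ (b : ℕ) + 1 = a ∨
      ((a : ℕ) = 0 ∧ (b : ℕ) + 1 = n) ∨ ((b : ℕ) = 0 ∧ (a : ℕ) + 1 = n) := by
  have hsub : ∀ a b : Fin n, ((a - b : Fin n) : ℕ) = 1 ↔
      (b : ℕ) + 1 = a ∨ ((a : ℕ) = 0 ∧ (b : ℕ) + 1 = n) := by
    intro a b
    have ha := a.2
    have hb := b.2
    rcases le_or_gt b a with hab | hab
    · rw [Fin.sub_val_of_le hab]
      have : (b : ℕ) ≤ a := hab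
      omega
    · rw [Fin.coe_sub_iff_lt.2 hab]
      have : (a : ℕ) < b := hab
      omega
  rw [SimpleGraph.cycleGraph_adj', hsub, hsub]
  tauto

/-- For odd `n` the function `k ↦ cos (k (π - π / n))` is an eigenfunction of the cycle. -/
theorem leastQEigenvalue_cycleGraph_le {n : ℕ} (hn : 3 ≤ n) (hodd : Odd n) :
    leastQEigenvalue (SimpleGraph.cycleGraph n) ≤ 2 - 2 * cos (π / n) := by
  obtain ⟨m, rfl⟩ := Nat.exists_eq_add_of_le' hn
  set N := m + 3 with hN
  have hN0 : (N : ℝ) ≠ 0 := by positivity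
  set ω : ℝ := π - π / N with hω
  have hperiod : ∃ r : ℕ, N * ω = r * (2 * π) := by
    obtain ⟨r, hr⟩ := hodd
    refine ⟨r, ?_⟩
    have : (N : ℝ) = 2 * r + 1 := by exact_mod_cast hr
    rw [hω, mul_sub, mul_div_cancel₀ _ hN0, this]
    ring
  obtain ⟨r, hr⟩ := hperiod
  have hmod : ∀ k : ℕ, cos ((k % N : ℕ) * ω) = cos (k * ω) := by
    intro k
    have hk : (k : ℝ) = (k % N : ℕ) + N * (k / N : ℕ) := by exact_mod_cast (Nat.mod_add_div k N).symm
    rw [show (k : ℝ) * ω = (k % N : ℕ) * ω + ((k / N * r : ℕ) : ℝ) * (2 * π) by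
      push_cast
      rw [mul_assoc, ← hr]
      linear_combination ω * hk, cos_add_nat_mul_two_pi]
  refine leastQEigenvalue_le_of_eigenfunction _ (x := fun v : Fin N => cos ((v : ℕ) * ω)) ?_ ?_
  · intro h
    have := congrFun h 0
    simp at this
  · intro v
    have hv := v.2
    rw [signlessAction_eq_sum _ _ _ {v - 1, v + 1}, Finset.sum_pair]
    · have e1 : cos (((v + 1 : Fin N) : ℕ) * ω) = cos (v * ω + ω) := by
        rw [Fin.val_add, hmod]
        rw [Fin.val_one, Nat.cast_add, Nat.cast_one, add_mul, one_mul]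
      have e2 : cos (((v - 1 : Fin N) : ℕ) * ω) = cos (v * ω - ω) := by
        rw [Fin.sub_def, hmod]
        rw [Nat.cast_add, Nat.cast_sub (by simp [hN])]
        rw [show ((N : ℝ) - ((1 : Fin N) : ℕ) + (v : ℕ)) * ω = (v : ℕ) * ω - ω + r * (2 * π) by
          rw [← hr]
          simp only [hN, Fin.val_one, Nat.cast_one]
          ring, cos_add_nat_mul_two_pi]
      rw [e1, e2, cos_add, cos_sub, show cos ω = -cos (π / N) by rw [hω, cos_pi_sub]]
      ring
    · intro h
      rw [sub_eq_iff_eq_add, add_assoc, left_eq_add, Fin.ext_iff, Fin.val_add, Fin.val_one,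
        Nat.mod_eq_of_lt (by omega)] at h
      exact absurd h (by simp)
    · intro w
      rw [← SimpleGraph.mem_neighborSet, SimpleGraph.cycleGraph_neighborSet]
      simp

/-- The relation of being consecutive, in either order, among `p 0, …, p m`. -/
def IsStep (p : ℕ → ℕ) (m a b : ℕ) : Prop :=
  ∃ k, k < m ∧ ((a = p k ∧ b = p (k + 1)) ∨ (b = p k ∧ a = p (k + 1)))

theorem IsStep.symm {p : ℕ → ℕ} {m a b : ℕ} (h : IsStep p m a b) : IsStep p m b a := by
  obtain ⟨k, hk, h⟩ := h
  exact ⟨k, hk, h.symm⟩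

/-- A parametrization of a θ-graph on `Fin n` from three sequences of natural numbers, where the
edges are given by a relation `E`. -/
theorem ThetaModel.of_paths {n : ℕ} {G : SimpleGraph (Fin n)} {E : ℕ → ℕ → Prop} {a b c : ℕ}
    {p q r : ℕ → ℕ} (hG : ∀ u v : Fin n, G.Adj u v ↔ E u v ∨ E v u)
    (hp : ∀ k ≤ a, p k < n) (hq : ∀ k ≤ b, q k < n) (hr : ∀ k ≤ c, r k < n)
    (hpq0 : p 0 = q 0) (hpr0 : p 0 = r 0) (hpq1 : p a = q b) (hpr1 : p a = r c)
    (ip : ∀ k ≤ a, ∀ l ≤ a, p k = p l → k = l) (iq : ∀ k ≤ b, ∀ l ≤ b, q k = q l → k = l)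
    (ir : ∀ k ≤ c, ∀ l ≤ c, r k = r l → k = l)
    (ipq : ∀ k ≤ a, ∀ l ≤ b, p k = q l → (k = 0 ∧ l = 0) ∨ (k = a ∧ l = b))
    (ipr : ∀ k ≤ a, ∀ l ≤ c, p k = r l → (k = 0 ∧ l = 0) ∨ (k = a ∧ l = c))
    (iqr : ∀ k ≤ b, ∀ l ≤ c, q k = r l → (k = 0 ∧ l = 0) ∨ (k = b ∧ l = c))
    (hcover : ∀ w < n, (∃ k ≤ a, p k = w) ∨ (∃ k ≤ b, q k = w) ∨ (∃ k ≤ c, r k = w))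
    (hE : ∀ u < n, ∀ v < n, E u v → IsStep p a u v ∨ IsStep q b u v ∨ IsStep r c u v)
    (ep : ∀ k < a, E (p k) (p (k + 1)) ∨ E (p (k + 1)) (p k))
    (eq : ∀ k < b, E (q k) (q (k + 1)) ∨ E (q (k + 1)) (q k))
    (er : ∀ k < c, E (r k) (r (k + 1)) ∨ E (r (k + 1)) (r k))
    (ha : 1 ≤ a) (hb : 2 ≤ b) (hc : 1 ≤ c) (hac : 3 ≤ a + c) (hbc : 3 ≤ b + c) :
    ∃ R, ThetaModel G ![a, b, c] R := by
  have hn : 0 < n := (Nat.zero_le _).trans_lt (hp 0 (Nat.zero_le _))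
  set ℓ : Fin 3 → ℕ := ![a, b, c] with hℓ
  set P : Fin 3 → ℕ → ℕ := ![p, q, r] with hP
  have hlt : ∀ i, ∀ k ≤ ℓ i, P i k < n := by
    intro i
    fin_cases i
    exacts [hp, hq, hr]
  have hval : ∀ i k, k ≤ ℓ i → P i k % n = P i k := fun i k hk => Nat.mod_eq_of_lt (hlt i k hk)
  have hstep : ∀ u v, (∃ i k, k < ℓ i ∧
      ((u = P i k ∧ v = P i (k + 1)) ∨ (v = P i k ∧ u = P i (k + 1)))) ↔
      IsStep p a u v ∨ IsStep q b u v ∨ IsStep r c u v := by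
    intro u v
    simp [Fin.exists_fin_succ, hℓ, hP, IsStep]
  refine ⟨fun i k => ⟨P i k % n, Nat.mod_lt _ hn⟩, ?_, ?_, ?_, ?_, ?_, ?_, ?_⟩
  · intro i j
    fin_cases i <;> fin_cases j <;> simp [hP, ← hpq0, ← hpr0]
  · intro i j
    fin_cases i <;> fin_cases j <;> simp [hP, hℓ, ← hpq1, ← hpr1]
  · intro i j k l hk hl h
    rw [Fin.mk.injEq, hval i k hk, hval j l hl] at h
    fin_cases i <;> fin_cases j
    · exact Or.inl ⟨rfl, ip k hk l hl h⟩
    · exact Or.inr (ipq k hk l hl h)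
    · exact Or.inr (ipr k hk l hl h)
    · exact Or.inr ((ipq l hl k hk h.symm).imp And.symm And.symm)
    · exact Or.inl ⟨rfl, iq k hk l hl h⟩
    · exact Or.inr (iqr k hk l hl h)
    · exact Or.inr ((ipr l hl k hk h.symm).imp And.symm And.symm)
    · exact Or.inr ((iqr l hl k hk h.symm).imp And.symm And.symm)
    · exact Or.inl ⟨rfl, ir k hk l hl h⟩
  · intro w
    have : ∃ i k, k ≤ ℓ i ∧ P i k = w := by
      rcases hcover w w.2 with h | h | h
      exacts [⟨0, h⟩, ⟨1, h⟩, ⟨2, h⟩]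
    obtain ⟨i, k, hk, hw⟩ := this
    exact ⟨i, k, hk, Fin.ext ((hval i k hk).trans hw)⟩
  · intro u v
    have h1 : (∃ i k, k < ℓ i ∧ ((u = (⟨P i k % n, Nat.mod_lt _ hn⟩ : Fin n) ∧
        v = (⟨P i (k + 1) % n, Nat.mod_lt _ hn⟩ : Fin n)) ∨
        (v = (⟨P i k % n, Nat.mod_lt _ hn⟩ : Fin n) ∧
        u = (⟨P i (k + 1) % n, Nat.mod_lt _ hn⟩ : Fin n)))) ↔
        ∃ i k, k < ℓ i ∧ (((u : ℕ) = P i k ∧ (v : ℕ) = P i (k + 1)) ∨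
          ((v : ℕ) = P i k ∧ (u : ℕ) = P i (k + 1))) := by
      refine exists_congr fun i => exists_congr fun k => and_congr_right fun hk => ?_
      simp only [Fin.ext_iff, hval i k hk.le, hval i (k + 1) hk]
    rw [h1, hstep, hG]
    constructor
    · rintro (h | h)
      · exact hE u u.2 v v.2 h
      · exact (hE v v.2 u u.2 h).imp IsStep.symm (Or.imp IsStep.symm IsStep.symm)
    · rintro (⟨k, hk, ⟨h, h'⟩ | ⟨h, h'⟩⟩ | ⟨k, hk, ⟨h, h'⟩ | ⟨h, h'⟩⟩ |
        ⟨k, hk, ⟨h, h'⟩ | ⟨h, h'⟩⟩) <;> rw [h, h']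
      exacts [ep k hk, (ep k hk).symm, eq k hk, (eq k hk).symm, er k hk, (er k hk).symm]
  · intro i
    fin_cases i <;> simp [hℓ] <;> omega
  · intro i j hij
    fin_cases i <;> fin_cases j <;> simp [hℓ] at hij ⊢ <;> omega

/-- `H(i)` is a θ-graph with ends `i`, `n - i`: the paths are the chord, the arc through increasing
indices, and the arc through `0`. -/
theorem chordedCycle_model {n i : ℕ} (hi : 1 ≤ i) (hin : 2 * i + 3 ≤ n) :
    ∃ R, ThetaModel (chordedCycle n i) ![1, n - 2 * i, 2 * i] R := by
  refine ThetaModel.of_paths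
    (E := fun u v => u + 1 = v ∨ (u = 0 ∧ v + 1 = n) ∨ (u = i ∧ v = n - i))
    (p := fun k => if k = 0 then i else n - i) (q := fun k => i + k)
    (r := fun k => if k ≤ i then i - k else n + i - k)
    ?_ ?_ ?_ ?_ ?_ ?_ ?_ ?_ ?_ ?_ ?_ ?_ ?_ ?_ ?_ ?_ ?_ ?_ ?_ ?_ ?_ ?_ ?_ ?_
  · intro u v
    unfold chordedCycle
    rw [SimpleGraph.sup_adj, cycleGraph_adj_iff (by omega), SimpleGraph.fromRel_adj, ne_eq,
      Fin.ext_iff]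
    omega
  · intro k hk; split_ifs <;> omega
  · intro k hk; omega
  · intro k hk; split_ifs <;> omega
  · simp
  · simp
  · simp; omega
  · simp; split_ifs <;> omega
  · intro k hk l hl; split_ifs <;> omega
  · intro k hk l hl; omega
  · intro k hk l hl; split_ifs <;> omega
  · intro k hk l hl; split_ifs <;> omega
  · intro k hk l hl; split_ifs <;> omega
  · intro k hk l hl; split_ifs <;> omega
  · intro w hw
    rcases le_or_gt w i with h1 | h1
    · exact Or.inr (Or.inr ⟨i - w, by omega, by split_ifs <;> omega⟩)
    · rcases le_or_gt w (n - i) with h2 | h2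
      · exact Or.inr (Or.inl ⟨w - i, by omega, by omega⟩)
      · exact Or.inr (Or.inr ⟨n + i - w, by omega, by split_ifs <;> omega⟩)
  · rintro u hu v hv (h | h | h)
    · by_cases h1 : v ≤ i
      · exact Or.inr (Or.inr ⟨i - v, by omega, by dsimp only; split_ifs <;> omega⟩)
      · by_cases h2 : v ≤ n - i
        · exact Or.inr (Or.inl ⟨u - i, by omega, by dsimp only; omega⟩)
        · exact Or.inr (Or.inr ⟨n + i - v, by omega, by dsimp only; split_ifs <;> omega⟩)
    · exact Or.inr (Or.inr ⟨i, by omega, by dsimp only; split_ifs <;> omega⟩)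
    · exact Or.inl ⟨0, by omega, by simpa using Or.inl h⟩
  · intro k hk
    obtain rfl : k = 0 := by omega
    simp
  · intro k hk; omega
  · intro k hk; split_ifs <;> omega
  all_goals omega

/-- `Θ` is a θ-graph with ends `2`, `n - 1`: two paths of length two through `0` and `1`, and the
path `2, 3, …, n - 1`. -/
theorem bigTheta_model {n : ℕ} (hn : 4 ≤ n) :
    ∃ R, ThetaModel (bigTheta n) ![2, 2, n - 3] R := by
  refine ThetaModel.of_paths
    (E := fun u v => (1 ≤ u ∧ v = u + 1) ∨ (u = n - 1 ∧ v = 1) ∨ (u = 0 ∧ (v = 2 ∨ v = n - 1)))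
    (p := fun k => if k = 0 then 2 else if k = 1 then 0 else n - 1)
    (q := fun k => if k = 0 then 2 else if k = 1 then 1 else n - 1)
    (r := fun k => k + 2)
    ?_ ?_ ?_ ?_ ?_ ?_ ?_ ?_ ?_ ?_ ?_ ?_ ?_ ?_ ?_ ?_ ?_ ?_ ?_ ?_ ?_ ?_ ?_ ?_
  · intro u v
    unfold bigTheta cyclePlusVertex
    rw [SimpleGraph.fromRel_adj, ne_eq, Fin.ext_iff]
    omega
  · intro k hk; split_ifs <;> omega
  · intro k hk; split_ifs <;> omega
  · intro k hk; omega
  · simp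
  · simp
  · simp
  · simp; omega
  · intro k hk l hl; grind
  · intro k hk l hl; grind
  · intro k hk l hl; omega
  · intro k hk l hl; grind
  · intro k hk l hl; grind
  · intro k hk l hl; grind
  · intro w hw
    by_cases h0 : w = 0
    · exact Or.inl ⟨1, by omega, by simp [h0]⟩
    · by_cases h1 : w = 1
      · exact Or.inr (Or.inl ⟨1, by omega, by simp [h1]⟩)
      · exact Or.inr (Or.inr ⟨w - 2, by omega, by omega⟩)
  · rintro u hu v hv (h | h | ⟨h, h' | h'⟩)
    · by_cases h1 : u = 1
      · exact Or.inr (Or.inl ⟨0, by omega, by simp; omega⟩)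
      · exact Or.inr (Or.inr ⟨u - 2, by omega, by dsimp only; omega⟩)
    · exact Or.inr (Or.inl ⟨1, by omega, by simp; omega⟩)
    · exact Or.inl ⟨0, by omega, by simp; omega⟩
    · exact Or.inl ⟨1, by omega, by simp; omega⟩
  · intro k hk; interval_cases k <;> simp
  · intro k hk; interval_cases k <;> simp
  · intro k hk; omega
  all_goals omega

end ThetaQ

theorem theorem1p2 {V : Type*} [Fintype V] (G : SimpleGraph V) (n : ℕ) (hn : 4 ≤ n)
    (hcard : Fintype.card V = n) (hθ : ThetaQ.IsThetaGraph G) (hnb : ¬ G.IsBipartite) :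
    (Odd n →
      ThetaQ.leastQEigenvalue (SimpleGraph.cycleGraph n) ≤ ThetaQ.leastQEigenvalue G ∧
      (ThetaQ.leastQEigenvalue (SimpleGraph.cycleGraph n) = ThetaQ.leastQEigenvalue G →
        Nonempty (G ≃g SimpleGraph.cycleGraph n) ∨
        ∃ i : ℕ, 1 ≤ i ∧ i ≤ (n - 3) / 2 ∧ Nonempty (G ≃g ThetaQ.chordedCycle n i))) ∧
    (Even n →
      ThetaQ.leastQEigenvalue (ThetaQ.bigTheta n) ≤ ThetaQ.leastQEigenvalue G ∧
      (ThetaQ.leastQEigenvalue (ThetaQ.bigTheta n) = ThetaQ.leastQEigenvalue G ↔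
        Nonempty (G ≃g ThetaQ.bigTheta n))) := by
  obtain ⟨ℓ₀, P₀, h₀⟩ := hθ.exists_model
  obtain ⟨ℓ, P, h, hab, hc⟩ := h₀.exists_parity hnb
  have hsum := h.card_add_one
  rw [hcard] at hsum
  have l0 := h.one_le 0
  have l1 := h.one_le 1
  have l2 := h.one_le 2
  have : Nonempty V := ⟨P 0 0⟩
  have : NeZero n := ⟨by omega⟩
  constructor
  · intro hodd
    obtain ⟨hle, heq⟩ := h.two_sub_le_leastQEigenvalue hab hc
    rw [hcard] at hle heq
    have hcyc := ThetaQ.leastQEigenvalue_cycleGraph_le (by omega) hodd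
    refine ⟨hcyc.trans hle, fun he => Or.inr ?_⟩
    -- A parametrization whose path `0` is the chord is one of the graph `H(ℓ 2 / 2)`.
    have key : ∀ {ℓ : Fin 3 → ℕ} {P : Fin 3 → ℕ → V}, ThetaQ.ThetaModel G ℓ P → ℓ 0 % 2 = ℓ 1 % 2 →
        ℓ 2 % 2 ≠ ℓ 0 % 2 → ℓ 0 = 1 →
        ∃ i : ℕ, 1 ≤ i ∧ i ≤ (n - 3) / 2 ∧ Nonempty (G ≃g ThetaQ.chordedCycle n i) := by
      intro ℓ P h hab hc h1
      have hsum := h.card_add_one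
      rw [hcard] at hsum
      have h01 := h.three_le 0 1 (by decide)
      have h02 := h.three_le 0 2 (by decide)
      obtain ⟨R, hR⟩ := ThetaQ.chordedCycle_model (n := n) (i := ℓ 2 / 2) (by omega) (by omega)
      refine ⟨ℓ 2 / 2, by omega, by omega, h.nonempty_iso (?_ : ThetaQ.ThetaModel _ ℓ R)⟩
      convert hR using 1
      ext j
      fin_cases j <;> simp <;> omega
    rcases heq (le_antisymm (he ▸ hcyc) hle) with h1 | h1
    · exact key h hab hc h1
    · exact key (h.perm (Equiv.swap 0 1)) (by simpa using hab.symm)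
        (by simpa [Equiv.swap_apply_def, ← hab] using hc) (by simpa using h1)
  · intro heven
    have hev := Nat.even_iff.1 heven
    obtain ⟨R, hR⟩ := ThetaQ.bigTheta_model hn
    have key : ThetaQ.leastQEigenvalue G ≤ ThetaQ.leastQEigenvalue (ThetaQ.bigTheta n) →
        Nonempty (G ≃g ThetaQ.bigTheta n) := by
      intro hle
      have he := h.lengths_eq_of_le hR rfl rfl (by simp; omega) (by simp; omega) (by omega)
        (by omega) (by omega) hle
      rw [← he] at hR
      exact h.nonempty_iso hR
    refine ⟨?_, fun he => key he.ge, fun ⟨e⟩ => (ThetaQ.leastQEigenvalue_eq_of_iso e).symm⟩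
    by_contra! hlt
    obtain ⟨e⟩ := key hlt.le
    exact hlt.ne (ThetaQ.leastQEigenvalue_eq_of_iso e)
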